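/- Let $\mathbb K$ be a field of characteristic $0$; chain complexes are $\mathbb Z$-graded with differential of degree $-1$, and $\mathbb S$-modules are reduced ($M(0)=0$). Let $\mathcal C=\bigoplus_{w\ge 0}\mathcal C^{(w)}$ be a connected weight graded cooperad ($\mathcal C^{(0)}=\mathrm I$, the decomposition map $\Delta$ and the counit preserve degree and weight), equipped with a square-zero coderivation $d_\varphi$ of degree $-1$ that lowers the weight by $1$; for instance $\mathcal C=\mathcal P^{¡}$, the Koszul dual dg cooperad of a Koszul operad $\mathcal P$. For chain complexes $A,B$ let $\mathrm{End}^A_B(m)=\mathrm{Hom}(A^{\otimes m},B)$, $\mathrm{End}_A=\mathrm{End}^A_A$, with the usual differential $\partial^A_B$, and consider the graded space $\mathrm{Hom}_{\mathbb S}(\mathcal C,\mathrm{End}^A_B)$ with the differential $(\partial^A_B)_*$, $f\mapsto \partial^A_B\circ f$. For $f\in \mathrm{Hom}_{\mathbb S}(\mathcal C,\mathrm{End}^A_B)$, $\mu\in\mathrm{Hom}_{\mathbb S}(\mathcal C,\mathrm{End}_A)$ and $\nu\in\mathrm{Hom}_{\mathbb S}(\mathcal C,\mathrm{End}_B)$ let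 $f*\mu$ be the composite $\mathcal C\xrightarrow{\Delta_{(1)}}\mathcal C\circ_{(1)}\mathcal C\xrightarrow{f\circ_{(1)}\mu}\mathrm{End}^A_B\circ_{(1)}\mathrm{End}_A\to\mathrm{End}^A_B$, where $\Delta_{(1)}$ is the infinitesimal decomposition map, and let $\nu\circledast f$ be the composite $\mathcal C\xrightarrow{\Delta}\mathcal C\circ\mathcal C\xrightarrow{\nu\circ f}\mathrm{End}_B\circ\mathrm{End}^A_B\to\mathrm{End}^A_B$; for $B=A$ write $\star$ for $*$. A homotopy algebra structure on $A$ is a degree $-1$ element $\mu\in\mathrm{Hom}_{\mathbb S}(\mathcal C,\mathrm{End}_A)$, vanishing on $\mathcal C^{(0)}$, with $\partial^A_A\mu+\mu d_\varphi+\mu\star\mu=0$ (for $\mathcal C=\mathcal P^{¡}$: a $\mathcal P_\infty$-algebra structure). An $\infty$-morphism $(A,\mu)\rightsquigarrow(B,\nu)$ is a degree $0$ element $f\in\mathrm{Hom}_{\mathbb S}(\mathcal C,\mathrm{End}^A_B)$ with $\partial^A_Bf-fd_\varphi=f*\mu-\nu\circledast f$. Write $\mu_{(k)},\nu_{(k)},f_{(k)}$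 for the restrictions to $\mathcal C^{(k)}$, extended by $0$ when needed, and $f_{(-1)}=0$. In weight $m$ the equation of $\infty$-morphisms reads $$(E_m)\qquad \partial^A_Bf_{(m)}-f_{(m-1)}d_\varphi=\sum_{k=1}^m f_{(m-k)}*\mu_{(k)}-\sum_{k=1}^m\nu_{(k)}\circledast f_{(m-k)},$$ where $\nu_{(k)}\circledast f_{(m-k)}$ means that the total weight of the various components of $f$ involved is $m-k$. Theorem. (1) Let $(A,d_A,\mu)$ and $(B,d_B,\nu)$ be two homotopy algebras, let $n\ge0$, and let $f_{(0)},\dots,f_{(n-1)}$, with $f_{(k)}\in\mathrm{Hom}_{\mathbb S}(\mathcal C^{(k)},\mathrm{End}^A_B)$ of degree $0$, satisfy $(E_m)$ for all $m<n$. Then $$\widetilde f_{(n)}:=\sum_{k=1}^n f_{(n-k)}*\mu_{(k)}-\sum_{k=1}^n\nu_{(k)}\circledast f_{(n-k)}+f_{(n-1)}d_\varphi,$$ which lives on $\mathcal C^{(n)}$ and has degree $-1$, is a cycle of the chain complex $\big(\mathrm{Hom}_{\mathbb S}(\mathcal C,\mathrm{End}^A_B),(\partial^A_B)_*\big)$.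 Moreover there exists $f_{(n)}\in\mathrm{Hom}_{\mathbb S}(\mathcal C^{(n)},\mathrm{End}^A_B)$ of degree $0$ satisfying $(E_n)$ if and only if $\widetilde f_{(n)}$ is a boundary in this complex. (2) Let $(A,d_A,\mu)$ be a homotopy algebra and let $(B,d_B)$ be an acyclic chain complex, viewed as a homotopy algebra with the trivial structure $0$. Then every chain map $\varphi:A\to B$ extends to an $\infty$-morphism $f:(A,\mu)\rightsquigarrow(B,0)$, that is, $f_{(0)}(\mathrm{id})=\varphi$, where $\mathrm{id}$ is the generator of $\mathcal C^{(0)}=\mathrm I$. -/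

import Mathlib

universe u

open scoped TensorProduct DirectSum

namespace InftyMor

/-! ### Graded modules -/

/-- A `ℤ`-graded vector space (homological degree), graded by internal direct sum. -/
structure GradedMod (K : Type u) [Field K] where
  carrier : Type u
  [grp : AddCommGroup carrier]
  [mod : Module K carrier]
  deg : ℤ → Submodule K carrier
  internal : DirectSum.IsInternal deg

attribute [instance] GradedMod.grp GradedMod.mod

instance instCoeSortGradedMod (K : Type u) [Field K] : CoeSort (GradedMod K) (Type u) :=
  ⟨GradedMod.carrier⟩

section graded

variable {K : Type u} [Field K]

/-- The linear maps `V → W` which are homogeneous of degree `p`. -/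
def DegHom (V W : GradedMod K) (p : ℤ) : Submodule K (V →ₗ[K] W) where
  carrier := {f | ∀ (i : ℤ) (v : V), v ∈ V.deg i → f v ∈ W.deg (i + p)}
  add_mem' hf hg i v hv := (W.deg _).add_mem (hf i v hv) (hg i v hv)
  zero_mem' _ _ _ := (W.deg _).zero_mem
  smul_mem' a _ hf i v hv := (W.deg _).smul_mem a (hf i v hv)

/-- Composition of homogeneous maps. -/
def DegHom.comp {U V W : GradedMod K} {p q r : ℤ} (g : DegHom V W q) (f : DegHom U V p)
    (h : r = p + q := by norm_num) : DegHom U W r :=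
  ⟨g.1 ∘ₗ f.1, fun i v hv => by
    have := g.2 _ _ (f.2 i v hv)
    rw [h, ← add_assoc]
    exact this⟩

/-- The identity, of degree `0`. -/
def DegHom.id (V : GradedMod K) : DegHom V V 0 :=
  ⟨LinearMap.id, fun i v hv => by simpa using hv⟩

theorem GradedMod.bijective (V : GradedMod K) :
    Function.Bijective (DirectSum.coeLinearMap V.deg) := V.internal

/-- The endomorphism of `V` acting on the degree `i` part by the scalar `χ i`. -/
noncomputable def GradedMod.scale (V : GradedMod K) (χ : ℤ → K) : V →ₗ[K] V :=
  (DirectSum.toModule K ℤ V fun i => χ i • (V.deg i).subtype) ∘ₗ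
    (LinearEquiv.ofBijective (DirectSum.coeLinearMap V.deg) V.bijective).symm.toLinearMap

theorem GradedMod.scale_apply (V : GradedMod K) (χ : ℤ → K) {i : ℤ} {v : V} (hv : v ∈ V.deg i) :
    V.scale χ v = χ i • v := by
  have : (LinearEquiv.ofBijective (DirectSum.coeLinearMap V.deg) V.bijective).symm v =
      DirectSum.lof K ℤ (fun i => V.deg i) i ⟨v, hv⟩ := by
    rw [LinearEquiv.symm_apply_eq]
    simp
  simp [GradedMod.scale, this]

theorem GradedMod.mem_iSup (V : GradedMod K) (v : V) : v ∈ ⨆ i, V.deg i := by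
  rw [V.internal.submodule_iSup_eq_top]
  trivial

theorem GradedMod.hom_ext {V : GradedMod K} {X : Type*} [AddCommGroup X] [Module K X]
    {f g : V →ₗ[K] X} (h : ∀ i, ∀ v ∈ V.deg i, f v = g v) : f = g := by
  ext v
  induction V.mem_iSup v using Submodule.iSup_induction' with
  | mem i x hx => exact h i x hx
  | zero => simp
  | add x y _ _ hx hy => rw [map_add, map_add, hx, hy]

theorem GradedMod.scale_comm {V W : GradedMod K} (χ : ℤ → K) (f : DegHom V W 0) (v : V) :
    f.1 (V.scale χ v) = W.scale χ (f.1 v) := by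
  have : f.1 ∘ₗ V.scale χ = W.scale χ ∘ₗ f.1 := by
    refine GradedMod.hom_ext fun i v hv => ?_
    have h2 : f.1 v ∈ W.deg i := by simpa using f.2 i v hv
    simp [V.scale_apply χ hv, W.scale_apply χ h2]
  exact LinearMap.congr_fun this v

theorem GradedMod.scale_mem (V : GradedMod K) (χ : ℤ → K) {i : ℤ} {v : V} (hv : v ∈ V.deg i) :
    V.scale χ v ∈ V.deg i := by
  rw [V.scale_apply χ hv]
  exact (V.deg i).smul_mem _ hv

/-- The sign operator `v ↦ (-1)^{|v|} v`. -/
noncomputable def GradedMod.sgn (V : GradedMod K) : V →ₗ[K] V :=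
  V.scale fun i => (-1 : K) ^ i

theorem sgn_apply (V : GradedMod K) {i : ℤ} {v : V} (hv : v ∈ V.deg i) :
    V.sgn v = (-1 : K) ^ i • v := V.scale_apply _ hv

/-- A property of the values of a multilinear map that holds on tuples of homogeneous vectors
holds on all tuples. -/
theorem multilinear_mem {V : GradedMod K} {X : Type*} [AddCommGroup X] [Module K X] {n : ℕ}
    (m : MultilinearMap K (fun _ : Fin n => V) X) (P : Submodule K X)
    (h : ∀ (v : Fin n → V) (q : Fin n → ℤ), (∀ i, v i ∈ V.deg (q i)) → m v ∈ P)
    (v : Fin n → V) : m v ∈ P := by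
  suffices H : ∀ (s : Finset (Fin n)) (v : Fin n → V),
      (∀ i, i ∉ s → ∃ q, v i ∈ V.deg q) → m v ∈ P from
    H Finset.univ v (by simp)
  intro s
  induction s using Finset.induction_on with
  | empty =>
    intro v hv
    choose q hq using fun i => hv i (by simp)
    exact h v q hq
  | insert a s ha ih =>
    intro v hv
    have key : ∀ x : V, m (Function.update v a x) ∈ P := by
      intro x
      induction V.mem_iSup x using Submodule.iSup_induction' with
      | mem i x hx =>
        refine ih _ fun j hj => ?_
        by_cases hja : j = a
        · subst hja
          exact ⟨i, by simpa using hx⟩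
        · rw [Function.update_of_ne hja]
          exact hv j (by simp [hja, hj])
      | zero => simp
      | add x y _ _ hx hy =>
        rw [m.map_update_add]
        exact P.add_mem hx hy
    simpa using key (v a)

end graded

/-! ### Chain complexes -/

/-- A `ℤ`-graded chain complex with differential of degree `-1`. -/
structure DGMod (K : Type u) [Field K] extends GradedMod K where
  d : DegHom toGradedMod toGradedMod (-1)
  d_comp_d : ∀ a, d.1 (d.1 a) = 0

/-- Vanishing homology: every cycle is a boundary. -/
def DGMod.Acyclic {K : Type u} [Field K] (B : DGMod K) : Prop :=
  ∀ b, B.d.1 b = 0 → ∃ b', B.d.1 b' = b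

/-! ### Weight graded `𝕊`-modules -/

/-- A reduced weight graded `𝕊`-module: for each arity `n` a module `C(n)` which is the direct sum
of the `C(n)_d^{(w)}`, for `d ∈ ℤ` the degree and `w ∈ ℕ` the weight, and on which the symmetric
group acts by maps that preserve degree and weight. The action is written on the left,
`σ • c = c • σ⁻¹`. -/
structure WSMod (K : Type u) [Field K] where
  obj : ℕ → GradedMod K
  weight : ∀ n, ℕ → Submodule K (obj n)
  weight_internal : ∀ n, DirectSum.IsInternal (weight n)
  deg_le : ∀ n i, (obj n).deg i ≤ ⨆ w, (obj n).deg i ⊓ weight n w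
  act : ∀ n, Equiv.Perm (Fin n) →* Module.End K (obj n)
  act_deg : ∀ n σ, act n σ ∈ DegHom (obj n) (obj n) 0
  act_weight : ∀ n σ w, ∀ c ∈ weight n w, act n σ c ∈ weight n w
  reduced : Subsingleton (obj 0)

section smod

variable {K : Type u} [Field K]

/-- Families of linear maps `C(n) → Hom(V^{⊗ n}, X)`, for `n ∈ ℕ`. -/
abbrev Fam (C : WSMod K) (V : GradedMod K) (X : Type u) [AddCommGroup X] [Module K X] : Type u :=
  ∀ n, C.obj n →ₗ[K] MultilinearMap K (fun _ : Fin n => V) X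

/-- Equivariance of a family of maps `C(n) → Hom(V^{⊗ n}, X)` for the symmetric groups, which
permute the factors of `V^{⊗ n}` with the Koszul sign. The condition is spelt out on the
transpositions of two adjacent factors, which generate the symmetric groups. -/
def IsEquivariant {C : WSMod K} {V : GradedMod K} {X : Type u} [AddCommGroup X] [Module K X]
    (f : Fam C V X) : Prop :=
  ∀ (n : ℕ) (i j : Fin n), (i : ℕ) + 1 = j → ∀ (c : C.obj n) (v : Fin n → V) (p q : ℤ),
    v i ∈ V.deg p → v j ∈ V.deg q →
      f n (C.act n (Equiv.swap i j) c) v = (-1 : K) ^ (p * q) • f n c (v ∘ Equiv.swap i j)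

/-- `Hom_𝕊(C, End^V_W)` in degree `p`, where `End^V_W(n) = Hom(V^{⊗ n}, W)`: the equivariant
families of maps `f : C(n) → Hom(V^{⊗ n}, W)` with `|f(c)(v₁, …, vₙ)| = |c| + |v₁| + ⋯ + |vₙ| + p`
on homogeneous elements. -/
def HomS (C : WSMod K) (V W : GradedMod K) (p : ℤ) : Submodule K (Fam C V W) where
  carrier := {f | IsEquivariant f ∧
    ∀ (n : ℕ) (a : ℤ) (c : C.obj n) (q : Fin n → ℤ) (v : Fin n → V),
      c ∈ (C.obj n).deg a → (∀ i, v i ∈ V.deg (q i)) → f n c v ∈ W.deg (a + ∑ i, q i + p)}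
  add_mem' hf hg := by
    refine ⟨fun n i j hij c v p q hp hq => ?_, fun n a c q v hc hv => ?_⟩
    · have h1 := hf.1 n i j hij c v p q hp hq
      have h2 := hg.1 n i j hij c v p q hp hq
      simp only [Pi.add_apply, LinearMap.add_apply, add_apply, smul_add, h1, h2]
    · exact (W.deg _).add_mem (hf.2 n a c q v hc hv) (hg.2 n a c q v hc hv)
  zero_mem' := ⟨fun n i j hij c v p q hp hq => by simp, fun n a c q v hc hv => (W.deg _).zero_mem⟩
  smul_mem' r f hf := by
    refine ⟨fun n i j hij c v p q hp hq => ?_, fun n a c q v hc hv => ?_⟩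
    · have h1 := hf.1 n i j hij c v p q hp hq
      simp only [Pi.smul_apply, LinearMap.smul_apply, smul_apply, h1]
      exact smul_comm _ _ _
    · exact (W.deg _).smul_mem r (hf.2 n a c q v hc hv)

/-! ### The Schur functor -/

/-- `⨁ₙ C(n) ⊗ V^{⊗ n}` -/
abbrev PreSchur (C : WSMod K) (V : GradedMod K) : Type u :=
  ⨁ n : ℕ, (C.obj n) ⊗[K] (⨂[K] _ : Fin n, V)

/-- The relations that define the coinvariants: `τc ⊗ v = ± c ⊗ τv`, with the Koszul sign, for the
transpositions `τ` of two adjacent factors, which generate the symmetric groups. -/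
def schurRel (C : WSMod K) (V : GradedMod K) : Submodule K (PreSchur C V) :=
  Submodule.span K {x | ∃ (n : ℕ) (i j : Fin n) (c : C.obj n) (v : Fin n → V) (p q : ℤ),
    (i : ℕ) + 1 = j ∧ v i ∈ V.deg p ∧ v j ∈ V.deg q ∧
    x = DirectSum.lof K ℕ (fun n => (C.obj n) ⊗[K] (⨂[K] _ : Fin n, V)) n
          (C.act n (Equiv.swap i j) c ⊗ₜ[K] PiTensorProduct.tprod K v) -
        (-1 : K) ^ (p * q) • DirectSum.lof K ℕ (fun n => (C.obj n) ⊗[K] (⨂[K] _ : Fin n, V)) n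
          (c ⊗ₜ[K] PiTensorProduct.tprod K (v ∘ Equiv.swap i j))}

/-- The underlying vector space of `C(V) = ⨁ₙ C(n) ⊗_{𝕊ₙ} V^{⊗ n}`. -/
abbrev SchurCarrier (C : WSMod K) (V : GradedMod K) : Type u :=
  PreSchur C V ⧸ schurRel C V

/-- The class `[c ⊗ v₁ ⊗ ⋯ ⊗ vₙ]` in `C(V)`, as a function of `c` and `v`. -/
noncomputable def mk (C : WSMod K) (V : GradedMod K) : Fam C V (SchurCarrier C V) := fun n =>
  { toFun := fun c =>
      ((schurRel C V).mkQ ∘ₗ DirectSum.lof K ℕ (fun n => (C.obj n) ⊗[K] (⨂[K] _ : Fin n, V)) n ∘ₗ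
        TensorProduct.mk K _ _ c).compMultilinearMap (PiTensorProduct.tprod K)
    map_add' := fun c c' => by ext v; simp
    map_smul' := fun r c => by ext v; simp }

theorem mk_apply (C : WSMod K) (V : GradedMod K) (n : ℕ) (c : C.obj n) (v : Fin n → V) :
    mk C V n c v = (schurRel C V).mkQ (DirectSum.lof K ℕ
      (fun n => (C.obj n) ⊗[K] (⨂[K] _ : Fin n, V)) n (c ⊗ₜ[K] PiTensorProduct.tprod K v)) := rfl

theorem mk_equivariant (C : WSMod K) (V : GradedMod K) : IsEquivariant (mk C V) := by
  intro n i j hij c v p q hp hq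
  rw [mk_apply, mk_apply, ← map_smul, ← sub_eq_zero, ← map_sub]
  rw [Submodule.mkQ_apply, Submodule.Quotient.mk_eq_zero]
  exact Submodule.subset_span ⟨n, i, j, c, v, p, q, hij, hp, hq, rfl⟩

theorem schur_hom_ext {C : WSMod K} {V : GradedMod K} {X : Type*} [AddCommGroup X] [Module K X]
    {f g : SchurCarrier C V →ₗ[K] X} (h : ∀ n c v, f (mk C V n c v) = g (mk C V n c v)) :
    f = g := by
  refine Submodule.linearMap_qext _ (DirectSum.linearMap_ext K fun n => ?_)
  refine TensorProduct.ext (LinearMap.ext fun c => PiTensorProduct.ext (MultilinearMap.ext ?_))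
  intro v
  exact h n c v

/-- The linear map `C(V) → X` induced by an equivariant family. -/
noncomputable def liftAux {C : WSMod K} {V : GradedMod K} {X : Type u} [AddCommGroup X]
    [Module K X] (f : Fam C V X) (hf : IsEquivariant f) : SchurCarrier C V →ₗ[K] X :=
  (schurRel C V).liftQ
    (DirectSum.toModule K ℕ X fun n =>
      TensorProduct.lift ((PiTensorProduct.lift (R := K)).toLinearMap ∘ₗ f n)) <| by
    rw [schurRel, Submodule.span_le]
    rintro x ⟨n, i, j, c, v, p, q, hij, hp, hq, rfl⟩
    simp only [SetLike.mem_coe, LinearMap.mem_ker, map_sub, map_smul, DirectSum.toModule_lof,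
      TensorProduct.lift.tmul, LinearMap.comp_apply, LinearEquiv.coe_coe,
      PiTensorProduct.lift.tprod]
    rw [hf n i j hij c v p q hp hq, sub_self]

@[simp]
theorem liftAux_mk {C : WSMod K} {V : GradedMod K} {X : Type u} [AddCommGroup X] [Module K X]
    (f : Fam C V X) (hf : IsEquivariant f) (n : ℕ) (c : C.obj n) (v : Fin n → V) :
    liftAux f hf (mk C V n c v) = f n c v := by
  rw [mk_apply]
  simp [liftAux]

/-- The degree `g` part of `C(V)`. -/
def schurDeg (C : WSMod K) (V : GradedMod K) (g : ℤ) : Submodule K (SchurCarrier C V) :=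
  Submodule.span K {x | ∃ (n : ℕ) (c : C.obj n) (v : Fin n → V) (a : ℤ) (q : Fin n → ℤ),
    c ∈ (C.obj n).deg a ∧ (∀ i, v i ∈ V.deg (q i)) ∧ a + ∑ i, q i = g ∧ x = mk C V n c v}

theorem mk_mem (C : WSMod K) (V : GradedMod K) {n : ℕ} {c : C.obj n} {v : Fin n → V} {a : ℤ}
    {q : Fin n → ℤ} (hc : c ∈ (C.obj n).deg a) (hv : ∀ i, v i ∈ V.deg (q i)) {g : ℤ}
    (hg : a + ∑ i, q i = g) : mk C V n c v ∈ schurDeg C V g :=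
  Submodule.subset_span ⟨n, c, v, a, q, hc, hv, hg, rfl⟩

theorem schurDeg_iSup (C : WSMod K) (V : GradedMod K) : ⨆ g, schurDeg C V g = ⊤ := by
  have key : ∀ n (c : C.obj n) (v : Fin n → V), mk C V n c v ∈ ⨆ g, schurDeg C V g := by
    intro n c v
    refine multilinear_mem _ _ (fun v q hv => ?_) v
    induction (C.obj n).mem_iSup c using Submodule.iSup_induction' with
    | mem a c hc => exact Submodule.mem_iSup_of_mem _ (mk_mem C V hc hv rfl)
    | zero => simp
    | add x y _ _ hx hy =>
      rw [map_add, add_apply]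
      exact Submodule.add_mem _ hx hy
  rw [eq_top_iff]
  have h : (⨆ g, schurDeg C V g).mkQ = 0 :=
    schur_hom_ext fun n c v => by
      rw [LinearMap.zero_apply, Submodule.mkQ_apply, Submodule.Quotient.mk_eq_zero]
      exact key n c v
  intro x _
  rw [← Submodule.Quotient.mk_eq_zero, ← Submodule.mkQ_apply, h, LinearMap.zero_apply]

theorem act_scale (C : WSMod K) (χ : ℤ → K) (n : ℕ) (σ : Equiv.Perm (Fin n)) (c : C.obj n) :
    C.act n σ ((C.obj n).scale χ c) = (C.obj n).scale χ (C.act n σ c) :=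
  GradedMod.scale_comm χ (⟨C.act n σ, C.act_deg n σ⟩ : DegHom _ _ 0) c

/-- The map `(c, v) ↦ [φ c ⊗ f₁ v₁ ⊗ ⋯ ⊗ fₙ vₙ]`, without Koszul signs. -/
noncomputable def tensorAt (C : WSMod K) (V W : GradedMod K) (n : ℕ)
    (φ : C.obj n →ₗ[K] C.obj n) (f : Fin n → (V →ₗ[K] W)) :
    C.obj n →ₗ[K] MultilinearMap K (fun _ : Fin n => V) (SchurCarrier C W) where
  toFun c := (mk C W n (φ c)).compLinearMap f
  map_add' c c' := by ext v; simp
  map_smul' r c := by ext v; simp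

@[simp]
theorem tensorAt_apply (C : WSMod K) (V W : GradedMod K) (n : ℕ)
    (φ : C.obj n →ₗ[K] C.obj n) (f : Fin n → (V →ₗ[K] W)) (c : C.obj n)
    (v : Fin n → V) : tensorAt C V W n φ f c v = mk C W n (φ c) (fun i => f i (v i)) := rfl

theorem tensorFam_equivariant (C : WSMod K) (V W : GradedMod K)
    (φ : ∀ n, C.obj n →ₗ[K] C.obj n) (f : V →ₗ[K] W)
    (hφ : ∀ n σ c, φ n (C.act n σ c) = C.act n σ (φ n c))
    (hf : ∀ i, ∀ v ∈ V.deg i, f v ∈ W.deg i) :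
    IsEquivariant (fun n => tensorAt C V W n (φ n) fun _ => f) := by
  intro n i j hij c v p q hp hq
  rw [tensorAt_apply, tensorAt_apply, hφ]
  exact mk_equivariant C W n i j hij (φ n c) (fun i => f (v i)) p q (hf _ _ hp) (hf _ _ hq)

theorem zpow_sum_eq {x : K} (hx : x ≠ 0) {ι : Type*} (s : Finset ι) (q : ι → ℤ) :
    x ^ (∑ i ∈ s, q i) = ∏ i ∈ s, x ^ q i := by
  classical
  induction s using Finset.induction_on with
  | empty => simp
  | insert a s ha ih => rw [Finset.sum_insert ha, Finset.prod_insert ha, zpow_add₀ hx, ih]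

theorem schurDeg_internal [CharZero K] (C : WSMod K) (V : GradedMod K) :
    DirectSum.IsInternal (schurDeg C V) := by
  refine DirectSum.isInternal_submodule_of_iSupIndep_of_iSup_eq_top ?_ (schurDeg_iSup C V)
  let χ : ℤ → K := fun i => (2 : K) ^ i
  have h2 : (2 : K) ≠ 0 := two_ne_zero
  have hχ : Function.Injective χ := by
    intro a b hab
    have : ((2 : ℚ) ^ a : ℚ) = (2 : ℚ) ^ b := by
      have h : (((2 : ℚ) ^ a : ℚ) : K) = (((2 : ℚ) ^ b : ℚ) : K) := by
        push_cast
        exact hab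
      exact_mod_cast h
    exact zpow_right_injective₀ (by norm_num) (by norm_num) this
  let E : SchurCarrier C V →ₗ[K] SchurCarrier C V :=
    liftAux (fun n => tensorAt C V V n ((C.obj n).scale χ) fun _ => V.scale χ)
      (tensorFam_equivariant C V V _ _ (fun n σ c => (act_scale C χ n σ c).symm)
        (fun i v hv => V.scale_mem χ hv))
  refine (((Module.End.eigenspaces_iSupIndep E).comp hχ)).mono ?_
  intro g
  rw [schurDeg, Submodule.span_le]
  rintro x ⟨n, c, v, a, q, hc, hv, rfl, rfl⟩
  rw [SetLike.mem_coe, Function.comp_apply, Module.End.mem_eigenspace_iff, liftAux_mk,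
    tensorAt_apply, GradedMod.scale_apply _ _ hc]
  have : (fun i => V.scale χ (v i)) = fun i => χ (q i) • v i :=
    funext fun i => V.scale_apply χ (hv i)
  rw [this, MultilinearMap.map_smul_univ, map_smul, smul_apply, smul_smul]
  congr 1
  simp only [χ]
  rw [zpow_add₀ h2, zpow_sum_eq h2]
  exact mul_comm _ _

/-- The Schur functor `C(V) = ⨁ₙ C(n) ⊗_{𝕊ₙ} V^{⊗ n}`, with its total degree. -/
noncomputable abbrev schur [CharZero K] (C : WSMod K) (V : GradedMod K) : GradedMod K where
  carrier := SchurCarrier C V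
  deg := schurDeg C V
  internal := schurDeg_internal C V

variable [CharZero K]

/-- The homogeneous map `C(V) → W` that corresponds to an element of `Hom_𝕊(C, End^V_W)`:
`[c ⊗ v₁ ⊗ ⋯ ⊗ vₙ] ↦ f(c)(v₁, …, vₙ)`. -/
noncomputable def lift {C : WSMod K} {V W : GradedMod K} {p : ℤ} (f : HomS C V W p) :
    DegHom (schur C V) W p :=
  ⟨liftAux f.1 f.2.1, by
    intro g x hx
    have h : schurDeg C V g ≤ (W.deg (g + p)).comap (liftAux f.1 f.2.1) := by
      rw [schurDeg, Submodule.span_le]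
      rintro x ⟨n, c, v, a, q, hc, hv, rfl, rfl⟩
      rw [SetLike.mem_coe, Submodule.mem_comap, liftAux_mk]
      exact f.2.2 n a c q v hc hv
    exact h hx⟩

/-- The element `c ↦ ((v₁, …, vₙ) ↦ h [c ⊗ v₁ ⊗ ⋯ ⊗ vₙ])` of `Hom_𝕊(C, End^V_W)` that corresponds to
a homogeneous map `h : C(V) → W`. This is inverse to `lift`. -/
noncomputable def restr {C : WSMod K} {V W : GradedMod K} {p : ℤ} (h : DegHom (schur C V) W p) :
    HomS C V W p :=
  ⟨fun n =>
    { toFun := fun c => LinearMap.compMultilinearMap (R := K) (M₂ := SchurCarrier C V) h.1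
        (mk C V n c)
      map_add' := fun c c' => by
        ext v
        exact (congrArg h.1 (by simp)).trans (map_add h.1 (mk C V n c v) (mk C V n c' v))
      map_smul' := fun r c => by
        ext v
        exact (congrArg h.1 (by simp)).trans (map_smul h.1 r (mk C V n c v)) }, by
    refine ⟨fun n i j hij c v p q hp hq => ?_, fun n a c q v hc hv => ?_⟩
    · exact (congrArg h.1 (mk_equivariant C V n i j hij c v p q hp hq)).trans
        (map_smul h.1 _ (mk C V n c (v ∘ Equiv.swap i j)))
    · exact h.2 _ _ (mk_mem C V hc hv rfl)⟩

/-- The Schur functor on maps of degree `0`: `C(f)[c ⊗ v₁ ⊗ ⋯ ⊗ vₙ] = [c ⊗ f v₁ ⊗ ⋯ ⊗ f vₙ]`. -/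
noncomputable def schurMap (C : WSMod K) {V W : GradedMod K} (f : DegHom V W 0) :
    DegHom (schur C V) (schur C W) 0 :=
  lift ⟨fun n => tensorAt C V W n LinearMap.id fun _ => f.1,
    tensorFam_equivariant C V W _ _ (fun _ _ _ => rfl) (fun i v hv => by simpa using f.2 i v hv),
    fun n a c q v hc hv => by
      rw [add_zero]
      exact mk_mem C W hc (fun i => by simpa using f.2 _ _ (hv i)) rfl⟩

/-- The factors of the `i`-th summand of the linearisation of the Schur functor. -/
noncomputable def linFactor {V W : GradedMod K} (f : DegHom V W 0) (g : DegHom V W (-1)) {n : ℕ}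
    (i j : Fin n) : V →ₗ[K] W :=
  if j < i then W.sgn ∘ₗ f.1 else if j = i then g.1 else f.1

/-- The family `(c, v) ↦ ∑ᵢ (-1)^{|c| + |v₁| + ⋯ + |vᵢ₋₁|} [c ⊗ f v₁ ⊗ ⋯ ⊗ g vᵢ ⊗ ⋯ ⊗ f vₙ]`. -/
noncomputable def linFam (C : WSMod K) {V W : GradedMod K} (f : DegHom V W 0)
    (g : DegHom V W (-1)) : Fam C V (SchurCarrier C W) := fun n =>
  ∑ i : Fin n, tensorAt C V W n (C.obj n).sgn (linFactor f g i)

theorem linFam_apply (C : WSMod K) {V W : GradedMod K} (f : DegHom V W 0)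
    (g : DegHom V W (-1)) (n : ℕ) (c : C.obj n) (v : Fin n → V) :
    linFam C f g n c v =
      ∑ i : Fin n, mk C W n ((C.obj n).sgn c) (fun j => linFactor f g i j (v j)) := by
  rw [linFam, LinearMap.sum_apply, sum_apply]
  rfl

theorem linFam_equivariant (C : WSMod K) {V W : GradedMod K} (f : DegHom V W 0)
    (g : DegHom V W (-1)) : IsEquivariant (linFam C f g) := by
  intro n a b hab c v p q hp hq
  have h1 : (-1 : K) ≠ 0 := by simp
  have hne : a ≠ b := fun h => by subst h; omega
  have hf : ∀ {i : ℤ} {x : V}, x ∈ V.deg i → f.1 x ∈ W.deg i := fun {i x} hx => by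
    simpa using f.2 i x hx
  rw [linFam_apply, linFam_apply, Finset.smul_sum, ← Equiv.sum_comp (Equiv.swap a b)]
  refine Finset.sum_congr rfl fun i _ => ?_
  have hact : (C.obj n).sgn (C.act n (Equiv.swap a b) c) =
      C.act n (Equiv.swap a b) ((C.obj n).sgn c) := (act_scale C _ n _ c).symm
  rw [hact]
  -- the `i'`-th tuple, with the entries `a` and `b` exchanged
  have heq : ∀ (i : Fin n) (j : Fin n), j ≠ a → j ≠ b →
      linFactor f g (Equiv.swap a b i) j = linFactor f g i j := by
    intro i j hja hjb
    by_cases hia : i = a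
    · subst hia
      rw [Equiv.swap_apply_left]
      unfold linFactor
      have e1 : j < b ↔ j < i := by
        rw [Fin.lt_def, Fin.lt_def]
        have := Fin.val_ne_of_ne hja
        omega
      simp only [e1, hja, hjb]
    · by_cases hib : i = b
      · subst hib
        rw [Equiv.swap_apply_right]
        unfold linFactor
        have e1 : j < a ↔ j < i := by
          rw [Fin.lt_def, Fin.lt_def]
          have := Fin.val_ne_of_ne hja
          omega
        simp only [e1, hja, hjb]
      · rw [Equiv.swap_apply_of_ne_of_ne hia hib]
  have main : ∀ (P Q : ℤ) (x y : Fin n → W) (α β : K), x a ∈ W.deg P → x b ∈ W.deg Q →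
      (∀ j, j ≠ a → j ≠ b → x j = y j) → x b = α • y a → x a = β • y b →
      (-1 : K) ^ (P * Q) * (α * β) = (-1) ^ (p * q) →
      mk C W n (C.act n (Equiv.swap a b) ((C.obj n).sgn c)) x =
        (-1 : K) ^ (p * q) • mk C W n ((C.obj n).sgn c) y := by
    intro P Q x y α β hP hQ hxy hα hβ hs
    rw [mk_equivariant C W n a b hab _ x P Q hP hQ]
    have hx : x ∘ Equiv.swap a b =
        fun j => (if j = a then α else if j = b then β else 1) • y j := by
      funext j
      by_cases hja : j = a
      · subst hja
        simp [hα]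
      · by_cases hjb : j = b
        · subst hjb
          simp [hβ, hja]
        · simp [hja, hjb, Equiv.swap_apply_of_ne_of_ne hja hjb, hxy j hja hjb]
    have hprod : ∏ j, (if j = a then α else if j = b then β else 1) = α * β := by
      rw [← Finset.prod_subset (Finset.subset_univ {a, b}), Finset.prod_pair hne]
      · simp [hne.symm]
      · intro j _ hj
        simp only [Finset.mem_insert, Finset.mem_singleton, not_or] at hj
        simp [hj.1, hj.2]
    rw [hx, MultilinearMap.map_smul_univ, hprod, smul_smul, hs]
  have hrest : ∀ j, j ≠ a → j ≠ b → linFactor f g (Equiv.swap a b i) j (v j) =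
      linFactor f g i j ((v ∘ Equiv.swap a b) j) := by
    intro j hja hjb
    rw [heq i j hja hjb, Function.comp_apply, Equiv.swap_apply_of_ne_of_ne hja hjb]
  have hsq : ∀ m : ℤ, (-1 : K) ^ m * (-1) ^ m = 1 := fun m => by
    rw [← mul_zpow]
    simp
  by_cases hia : i = a
  · subst hia
    refine main p (q + -1) _ _ 1 ((-1) ^ p) ?_ ?_ hrest ?_ ?_ ?_
    · have h : i < b := by rw [Fin.lt_def]; omega
      simp only [Equiv.swap_apply_left, linFactor, h, if_true]
      exact W.scale_mem _ (hf hp)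
    · simpa [linFactor] using g.2 _ _ hq
    · simp [linFactor]
    · have h : i < b := by rw [Fin.lt_def]; omega
      simp [linFactor, h, h.not_gt, hne.symm, sgn_apply W (hf hp)]
    · rw [mul_add, zpow_add₀ h1, mul_neg_one, zpow_neg, one_mul, mul_assoc,
        inv_mul_cancel₀ (zpow_ne_zero _ h1), mul_one]
  · by_cases hib : i = b
    · subst hib
      have h : a < i := by rw [Fin.lt_def]; omega
      refine main (p + -1) q _ _ ((-1) ^ q) 1 ?_ ?_ hrest ?_ ?_ ?_
      · simpa [linFactor] using g.2 _ _ hp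
      · simp only [Equiv.swap_apply_right, linFactor, h.not_gt, hne.symm, if_false]
        exact hf hq
      · simp only [Equiv.swap_apply_right, linFactor, h.not_gt, hne.symm, if_false, h, if_true,
          Function.comp_apply, Equiv.swap_apply_left, LinearMap.comp_apply]
        rw [sgn_apply W (hf hq), smul_smul, hsq, one_smul]
      · simp [linFactor]
      · rw [add_mul, zpow_add₀ h1, neg_one_mul, zpow_neg, mul_one, mul_assoc,
          inv_mul_cancel₀ (zpow_ne_zero _ h1), mul_one]
    · have hi : Equiv.swap a b i = i := Equiv.swap_apply_of_ne_of_ne hia hib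
      rcases lt_or_gt_of_ne hia with h | h
      · have h' : i < b := by rw [Fin.lt_def] at *; omega
        refine main p q _ _ 1 1 ?_ ?_ hrest ?_ ?_ (by simp)
        · simpa [hi, linFactor, h.not_gt, Ne.symm hia] using hf hp
        · simpa [hi, linFactor, h'.not_gt, Ne.symm hib] using hf hq
        · simp [hi, linFactor, h.not_gt, h'.not_gt, Ne.symm hia, Ne.symm hib]
        · simp [hi, linFactor, h.not_gt, h'.not_gt, Ne.symm hia, Ne.symm hib]
      · have h' : b < i := by
          have := Fin.val_ne_of_ne hib
          rw [Fin.lt_def] at *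
          omega
        refine main p q _ _ 1 1 ?_ ?_ hrest ?_ ?_ (by simp)
        · simp only [hi, linFactor, h, if_true]
          exact W.scale_mem _ (hf hp)
        · simp only [hi, linFactor, h', if_true]
          exact W.scale_mem _ (hf hq)
        · simp [hi, linFactor, h, h']
        · simp [hi, linFactor, h, h']

theorem linFactor_mem {V W : GradedMod K} (f : DegHom V W 0) (g : DegHom V W (-1)) {n : ℕ}
    (i j : Fin n) {v : V} {q : ℤ} (hv : v ∈ V.deg q) :
    linFactor f g i j v ∈ W.deg (if j = i then q + -1 else q) := by
  have hf : f.1 v ∈ W.deg q := by simpa using f.2 q v hv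
  unfold linFactor
  by_cases h : j < i
  · rw [if_pos h, if_neg h.ne]
    exact W.scale_mem _ hf
  · rw [if_neg h]
    by_cases h' : j = i
    · rw [if_pos h', if_pos h']
      exact g.2 q v hv
    · rw [if_neg h', if_neg h']
      exact hf

/-- The linearised Schur functor `C(f; g) : C(V) → C(W)`, for `f` of degree `0` and `g` of
degree `-1`:
`C(f; g)[c ⊗ v₁ ⊗ ⋯ ⊗ vₙ] = ∑ᵢ ± [c ⊗ f v₁ ⊗ ⋯ ⊗ f vᵢ₋₁ ⊗ g vᵢ ⊗ f vᵢ₊₁ ⊗ ⋯ ⊗ f vₙ]`,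
with the Koszul sign `(-1)^{|c| + |v₁| + ⋯ + |vᵢ₋₁|}`. For `f = id`, this is `id_C ∘' g`. -/
noncomputable def schurLin (C : WSMod K) {V W : GradedMod K} (f : DegHom V W 0)
    (g : DegHom V W (-1)) : DegHom (schur C V) (schur C W) (-1) :=
  lift ⟨linFam C f g, linFam_equivariant C f g, fun n a c q v hc hv => by
    rw [linFam_apply]
    refine Submodule.sum_mem _ fun i _ => ?_
    refine mk_mem C W ((C.obj n).scale_mem _ hc) (fun j => linFactor_mem f g i j (hv j)) ?_
    have : ∀ j, (if j = i then q j + -1 else q j) = q j + if j = i then -1 else 0 := by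
      intro j
      split_ifs <;> simp
    simp only [this, Finset.sum_add_distrib, Finset.sum_ite_eq', Finset.mem_univ, if_true]
    ring⟩

/-- The part of weight `w` of `C(V)`, for a module `V` with parts `𝒲 w` of weight `w`: it is spanned
by the `[c ⊗ v₁ ⊗ ⋯ ⊗ vₙ]` whose weights add up to `w`. -/
noncomputable def schurWeight (C : WSMod K) (V : GradedMod K) (𝒲 : ℕ → Submodule K V) (w : ℕ) :
    Submodule K (schur C V) :=
  Submodule.span K {x : SchurCarrier C V | ∃ (n : ℕ) (c : C.obj n) (v : Fin n → V) (a : ℕ)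
    (q : Fin n → ℕ), c ∈ C.weight n a ∧ (∀ i, v i ∈ 𝒲 (q i)) ∧ a + ∑ i, q i = w ∧
    x = mk C V n c v}

/-- The weight grading of a module concentrated in weight `0`. -/
def weightZero (V : GradedMod K) (w : ℕ) : Submodule K V := if w = 0 then ⊤ else ⊥

/-- The family `C(n) → Hom(V^{⊗ n}, V)` given by `c ↦ e(c) • id` in arity `1` and by `0` in the
other arities. -/
noncomputable def counitFam (C : WSMod K) (e : C.obj 1 →ₗ[K] K) (V : GradedMod K) : Fam C V V
  | 1 => (LinearMap.toSpanSingleton K _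
      (MultilinearMap.ofSubsingleton K V V (0 : Fin 1) LinearMap.id)) ∘ₗ e
  | _ => 0

/-- The map `C(V) → I(V) = V` induced by a map `e : C → I` of degree `0`. -/
noncomputable def counitMap (C : WSMod K) (e : C.obj 1 →ₗ[K] K)
    (he : ∀ i, i ≠ 0 → ∀ c ∈ (C.obj 1).deg i, e c = 0) (V : GradedMod K) :
    DegHom (schur C V) V 0 :=
  lift ⟨counitFam C e V, by
    intro n i j hij c v p q hp hq
    match n with
    | 0 => exact i.elim0
    | 1 => omega
    | n + 2 => simp [counitFam], by
    intro n a c q v hc hv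
    match n with
    | 0 => exact (V.deg _).zero_mem
    | 1 =>
      by_cases ha : a = 0
      · subst ha
        simpa [counitFam] using (V.deg _).smul_mem (e c) (hv 0)
      · simp [counitFam, he a ha c hc]
    | n + 2 => exact (V.deg _).zero_mem⟩

/-- The projection of `C(n)` onto its part of weight `w`. -/
noncomputable def WSMod.proj (C : WSMod K) (n w : ℕ) : C.obj n →ₗ[K] C.obj n :=
  (C.weight n w).subtype ∘ₗ DirectSum.component K ℕ (fun w => C.weight n w) w ∘ₗ
    (LinearEquiv.ofBijective (DirectSum.coeLinearMap (C.weight n))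
      (show Function.Bijective (DirectSum.coeLinearMap (C.weight n)) from
        C.weight_internal n)).symm.toLinearMap

theorem WSMod.proj_apply (C : WSMod K) {n w w' : ℕ} {c : C.obj n} (hc : c ∈ C.weight n w') :
    C.proj n w c = if w' = w then c else 0 := by
  have : (LinearEquiv.ofBijective (DirectSum.coeLinearMap (C.weight n))
      (show Function.Bijective (DirectSum.coeLinearMap (C.weight n)) from
        C.weight_internal n)).symm c =
      DirectSum.lof K ℕ (fun w => C.weight n w) w' ⟨c, hc⟩ := by
    rw [LinearEquiv.symm_apply_eq]
    simp
  by_cases h : w' = w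
  · subst h
    simp [WSMod.proj, this, DirectSum.component.lof_self]
  · simp [WSMod.proj, this, h, DirectSum.component.of]

theorem WSMod.hom_ext (C : WSMod K) {n : ℕ} {X : Type*} [AddCommGroup X] [Module K X]
    {f g : C.obj n →ₗ[K] X} (h : ∀ w, ∀ c ∈ C.weight n w, f c = g c) : f = g := by
  ext c
  have hc : c ∈ ⨆ w, C.weight n w := by
    rw [(C.weight_internal n).submodule_iSup_eq_top]
    trivial
  induction hc using Submodule.iSup_induction' with
  | mem i x hx => exact h i x hx
  | zero => simp
  | add x y _ _ hx hy => rw [map_add, map_add, hx, hy]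

theorem WSMod.act_proj (C : WSMod K) (n w : ℕ) (σ : Equiv.Perm (Fin n)) (c : C.obj n) :
    C.proj n w (C.act n σ c) = C.act n σ (C.proj n w c) := by
  have : C.proj n w ∘ₗ C.act n σ = C.act n σ ∘ₗ C.proj n w := by
    refine C.hom_ext fun w' c hc => ?_
    rw [LinearMap.comp_apply, LinearMap.comp_apply, C.proj_apply hc,
      C.proj_apply (C.act_weight n σ w' c hc)]
    split_ifs <;> simp
  exact LinearMap.congr_fun this c

theorem WSMod.proj_deg (C : WSMod K) (n w : ℕ) {i : ℤ} {c : C.obj n} (hc : c ∈ (C.obj n).deg i) :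
    C.proj n w c ∈ (C.obj n).deg i := by
  have h := C.deg_le n i hc
  clear hc
  induction h using Submodule.iSup_induction' with
  | mem w' x hx =>
    rw [C.proj_apply hx.2]
    split_ifs
    · exact hx.1
    · exact Submodule.zero_mem _
  | zero => simp
  | add x y _ _ hx hy =>
    rw [map_add]
    exact Submodule.add_mem _ hx hy

/-- The restriction `f_{(w)}` of an element of `Hom_𝕊(C, End^V_W)` to the part of weight `w` of `C`,
extended by `0` to the other weights. -/
noncomputable def wpart {C : WSMod K} {V W : GradedMod K} {p : ℤ} (w : ℕ) (f : HomS C V W p) :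
    HomS C V W p :=
  ⟨fun n => f.1 n ∘ₗ C.proj n w, by
    refine ⟨fun n i j hij c v p q hp hq => ?_, fun n a c q v hc hv => ?_⟩
    · rw [LinearMap.comp_apply, LinearMap.comp_apply, C.act_proj]
      exact f.2.1 n i j hij _ v p q hp hq
    · exact f.2.2 n a _ q v (C.proj_deg n w hc) hv⟩

/-- The element `f` lives on the part of weight `w` of `C`, that is, it is an element of
`Hom_𝕊(C^{(w)}, End^V_W)` extended by `0`. -/
def InWeight {C : WSMod K} {V W : GradedMod K} {p : ℤ} (w : ℕ) (f : HomS C V W p) : Prop :=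
  ∀ n w', w' ≠ w → ∀ c ∈ C.weight n w', f.1 n c = 0

/-- The equivariant endomorphisms of degree `-1` of an `𝕊`-module. -/
structure SEnd (C : WSMod K) where
  toFun : ∀ n, DegHom (C.obj n) (C.obj n) (-1)
  equivariant : ∀ n σ c, (toFun n).1 (C.act n σ c) = C.act n σ ((toFun n).1 c)

/-- `δ ∘ id_V : C(V) → C(V)`, `[c ⊗ v₁ ⊗ ⋯ ⊗ vₙ] ↦ [δ(c) ⊗ v₁ ⊗ ⋯ ⊗ vₙ]`. -/
noncomputable def SEnd.schur {C : WSMod K} (δ : SEnd C) (V : GradedMod K) :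
    DegHom (schur C V) (schur C V) (-1) :=
  lift ⟨fun n => tensorAt C V V n (δ.toFun n).1 fun _ => LinearMap.id,
    tensorFam_equivariant C V V _ _ δ.equivariant (fun _ _ hv => hv),
    fun n a c q v hc hv => mk_mem C V ((δ.toFun n).2 a c hc) hv (by ring)⟩

/-- The element `f δ : c ↦ f(δ(c))` of `Hom_𝕊(C, End^V_W)`. -/
def precomp {C : WSMod K} {V W : GradedMod K} {p q : ℤ} (f : HomS C V W p) (δ : SEnd C)
    (h : q = p - 1 := by norm_num) : HomS C V W q :=
  ⟨fun n => f.1 n ∘ₗ (δ.toFun n).1, by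
    refine ⟨fun n i j hij c v p q hp hq => ?_, fun n a c r v hc hv => ?_⟩
    · rw [LinearMap.comp_apply, LinearMap.comp_apply, δ.equivariant]
      exact f.2.1 n i j hij _ v p q hp hq
    · have := f.2.2 n (a + -1) _ r v ((δ.toFun n).2 a c hc) hv
      rw [show a + ∑ i, r i + q = a + -1 + ∑ i, r i + p by rw [h]; ring]
      exact this⟩

end smod

/-! ### Cooperads -/

/-- A connected weight graded cooperad.

The `𝕊`-modules are determined by their Schur functors `V ↦ C(V)` on dg modules, the composite
product of `𝕊`-modules corresponds to the composite of Schur functors and the unit `I` to the identity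
functor, so that a cooperad, that is, a comonoid `(C, Δ, ε)` for the composite product, is a comonad
structure on the Schur functor. This is how the structure is recorded here: `comul V` is the map
`C(V) → (C ∘ C)(V) = C(C(V))` induced by `Δ`. It is natural in the maps `f` of degree `0`, and in
the linearised maps `(f; g)` with `g` of degree `-1`. The latter says that it is natural over dg modules
and not only over graded modules: for a differential `d` on `V`, it says that `Δ` commutes with
the differentials induced by `d` on `C(V)` and on `C(C(V))`.

Connected means that the part of weight `0` is `I`. -/
structure Cooperad (K : Type u) [Field K] [CharZero K] extends WSMod K where
  counit : obj 1 →ₗ[K] K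
  counit_deg : ∀ i, i ≠ 0 → ∀ c ∈ (obj 1).deg i, counit c = 0
  counit_weight : ∀ w, w ≠ 0 → ∀ c ∈ weight 1 w, counit c = 0
  comul : ∀ V : GradedMod K, DegHom (schur toWSMod V) (schur toWSMod (schur toWSMod V)) 0
  comul_weight : ∀ (V : GradedMod K) (w : ℕ), ∀ x ∈ schurWeight toWSMod V (weightZero V) w,
    (comul V).1 x ∈ schurWeight toWSMod (schur toWSMod V)
      (schurWeight toWSMod V (weightZero V)) w
  comul_map : ∀ {V W : GradedMod K} (f : DegHom V W 0),
    (comul W).1 ∘ₗ (schurMap toWSMod f).1 =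
      (schurMap toWSMod (schurMap toWSMod f)).1 ∘ₗ (comul V).1
  comul_lin : ∀ {V W : GradedMod K} (f : DegHom V W 0) (g : DegHom V W (-1)),
    (comul W).1 ∘ₗ (schurLin toWSMod f g).1 =
      (schurLin toWSMod (schurMap toWSMod f) (schurLin toWSMod f g)).1 ∘ₗ (comul V).1
  coassoc : ∀ V : GradedMod K,
    (schurMap toWSMod (comul V)).1 ∘ₗ (comul V).1 =
      (comul (schur toWSMod V)).1 ∘ₗ (comul V).1
  counit_left : ∀ V : GradedMod K,
    (counitMap toWSMod counit counit_deg (schur toWSMod V)).1 ∘ₗ (comul V).1 = LinearMap.id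
  counit_right : ∀ V : GradedMod K,
    (schurMap toWSMod (counitMap toWSMod counit counit_deg V)).1 ∘ₗ (comul V).1 = LinearMap.id
  one : obj 1
  one_deg : one ∈ (obj 1).deg 0
  weight_zero_one : weight 1 0 = Submodule.span K {one}
  weight_zero_ne_one : ∀ n, n ≠ 1 → weight n 0 = ⊥
  counit_one : counit one = 1

/-- The map `C(V) → V` induced by the counit `C → I`. -/
noncomputable def Cooperad.eps {K : Type u} [Field K] [CharZero K] (C : Cooperad K)
    (V : GradedMod K) : DegHom (schur C.toWSMod V) V 0 :=
  counitMap C.toWSMod C.counit C.counit_deg V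

/-- A connected weight graded cooperad with a square-zero coderivation `dφ` of degree `-1` which
lowers the weight by `1`, such as the Koszul dual dg cooperad `P^¡ = (qP^¡, d_φ)` of a
quadratic-linear operad `P`. -/
structure DGCooperad (K : Type u) [Field K] [CharZero K] extends Cooperad K where
  dφ : SEnd toWSMod
  dφ_weight_zero : ∀ n, ∀ c ∈ weight n 0, (dφ.toFun n).1 c = 0
  dφ_weight_succ : ∀ n w, ∀ c ∈ weight n (w + 1), (dφ.toFun n).1 c ∈ weight n w
  dφ_dφ : ∀ n c, (dφ.toFun n).1 ((dφ.toFun n).1 c) = 0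
  counit_dφ : ∀ c, counit ((dφ.toFun 1).1 c) = 0
  coderivation : ∀ V : GradedMod K,
    (comul V).1 ∘ₗ (dφ.schur V).1 =
      ((dφ.schur (schur toWSMod V)).1 + (schurLin toWSMod (DegHom.id _) (dφ.schur V)).1) ∘ₗ
        (comul V).1

section infty

variable {K : Type u} [Field K] [CharZero K] {C : DGCooperad K}

/-! ### Homotopy algebras and `∞`-morphisms -/

/-- The differential `(∂^A_B)_*` of `Hom_𝕊(C, End^A_B)`: `c ↦ ∂^A_B(f(c))`, where
`∂^A_B(h) = d_B h - (-1)^{|h|} h d_{A^{⊗ n}}` and where `|f(c)| = |f| + |c|`. -/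
noncomputable def diff {A B : DGMod K} {p q : ℤ}
    (f : HomS C.toWSMod A.toGradedMod B.toGradedMod p) (h : q = p - 1 := by norm_num) :
    HomS C.toWSMod A.toGradedMod B.toGradedMod q :=
  restr (DegHom.comp B.d (lift f) (by rw [h]; ring)) -
    (-1 : K) ^ p • 
      restr (DegHom.comp (lift f) (schurLin C.toWSMod (DegHom.id _) A.d) (by rw [h]; ring))

/-- The product `f ∗ μ`, given by `C → C ∘₍₁₎ C → End^A_B ∘₍₁₎ End_A → End^A_B`, where the first map
is the infinitesimal decomposition map `Δ₍₁₎` and the second one is `f ∘₍₁₎ μ`. Evaluated on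
elements of `A`, it is the composite
`C(A) → C(C(A)) → C(A) → B` of `Δ`, of `C(ε; μ)`, and of `f`. For `B = A` and for `f` of degree `-1`,
this is the pre-Lie product `f ⋆ μ`. -/
noncomputable def ast {A B : DGMod K} {p q : ℤ}
    (f : HomS C.toWSMod A.toGradedMod B.toGradedMod p)
    (μ : HomS C.toWSMod A.toGradedMod A.toGradedMod (-1)) (h : q = p - 1 := by norm_num) :
    HomS C.toWSMod A.toGradedMod B.toGradedMod q :=
  restr (DegHom.comp (lift f)
    (DegHom.comp (r := -1) (schurLin C.toWSMod (C.eps A.toGradedMod) (lift μ))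
      (C.comul A.toGradedMod)) (by rw [h]; ring))

/-- The product `ν ⊛ f`, given by `C → C ∘ C → End_B ∘ End^A_B → End^A_B`, where the first map is `Δ`
and the second one is `ν ∘ f`. Evaluated on elements of `A`, it is the composite
`C(A) → C(C(A)) → C(B) → B` of `Δ`, of `C(f)`, and of `ν`. -/
noncomputable def circledast {A B : DGMod K}
    (ν : HomS C.toWSMod B.toGradedMod B.toGradedMod (-1))
    (f : HomS C.toWSMod A.toGradedMod B.toGradedMod 0) :
    HomS C.toWSMod A.toGradedMod B.toGradedMod (-1) :=
  restr (DegHom.comp (lift ν)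
    (DegHom.comp (r := 0) (schurMap C.toWSMod (lift f)) (C.comul A.toGradedMod)))

theorem lift_zero {C : WSMod K} {V W : GradedMod K} {p : ℤ} : (lift (0 : HomS C V W p)) = 0 :=
  Subtype.ext (schur_hom_ext fun n c v => liftAux_mk _ (0 : HomS C V W p).2.1 n c v)

theorem diff_zero {A B : DGMod K} {p q : ℤ} (h : q = p - 1) :
    diff (0 : HomS C.toWSMod A.toGradedMod B.toGradedMod p) h = 0 := by
  rw [diff, lift_zero]
  apply Subtype.ext
  funext n
  ext c v
  have e1 : B.d.1 (0 : B.toGradedMod) = 0 := map_zero _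
  have e2 : B.d.1 (0 : B.toGradedMod) - (-1 : K) ^ p • (0 : B.toGradedMod) = 0 := by
    rw [e1, smul_zero, sub_zero]
  exact e2

/-- A homotopy algebra structure on a chain complex `A`: an element `μ` of degree `-1` of
`Hom_𝕊(C, End_A)` that vanishes on the coaugmentation and satisfies the Maurer-Cartan equation
`∂(μ) + μ ⋆ μ = 0`, where `∂(μ) = ∂_A μ + μ dφ`. -/
structure HomotopyAlgebra (C : DGCooperad K) (A : DGMod K) where
  μ : HomS C.toWSMod A.toGradedMod A.toGradedMod (-1)
  vanish : wpart 0 μ = 0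
  maurerCartan : (diff μ : HomS C.toWSMod A.toGradedMod A.toGradedMod (-2)) + precomp μ C.dφ +
    ast μ μ = 0

/-- The trivial homotopy algebra structure `μ = 0`. -/
noncomputable def HomotopyAlgebra.trivial (C : DGCooperad K) (A : DGMod K) :
    HomotopyAlgebra C A where
  μ := 0
  vanish := rfl
  maurerCartan := by
    rw [diff_zero]
    have h1 : precomp (0 : HomS C.toWSMod A.toGradedMod A.toGradedMod (-1)) C.dφ =
        (0 : HomS C.toWSMod A.toGradedMod A.toGradedMod (-2)) := rfl
    have h2 : ast (0 : HomS C.toWSMod A.toGradedMod A.toGradedMod (-1)) 0 =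
        (0 : HomS C.toWSMod A.toGradedMod A.toGradedMod (-2)) := by
      rw [ast, lift_zero]
      rfl
    rw [h1, h2, add_zero, add_zero]

/-- The `∞`-morphisms `(A, μ) ⇝ (B, ν)`: the elements `f` of degree `0` of `Hom_𝕊(C, End^A_B)` such
that `∂(f) = f ∗ μ - ν ⊛ f`, where `∂(f) = ∂^A_B f - f dφ`. -/
def IsInftyMorphism {A B : DGMod K} (μ : HomotopyAlgebra C A) (ν : HomotopyAlgebra C B)
    (f : HomS C.toWSMod A.toGradedMod B.toGradedMod 0) : Prop :=
  (diff f : HomS C.toWSMod A.toGradedMod B.toGradedMod (-1)) - precomp f C.dφ =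
    ast f μ.μ - circledast ν.μ f

/-! ### The components of an `∞`-morphism -/

/-- `f₍ₙ₋₁₎`, which is `0` for `n = 0`. -/
def prev {A B : DGMod K} (f : ℕ → HomS C.toWSMod A.toGradedMod B.toGradedMod 0) :
    ℕ → HomS C.toWSMod A.toGradedMod B.toGradedMod 0
  | 0 => 0
  | n + 1 => f n

/-- The element `∑_{k=1}^n f₍ₙ₋ₖ₎ ∗ μ₍ₖ₎ - ∑_{k=1}^n ν₍ₖ₎ ⊛ f₍ₙ₋ₖ₎`. In the `k`-th term of the second
sum, the total weight of the various components of `f` is equal to `n - k`: that term is the part of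
weight `n` of the product of `ν₍ₖ₎` with `f₍₀₎ + ⋯ + f₍ₙ₋₁₎`. -/
noncomputable def weightRHS {A B : DGMod K} (μ : HomotopyAlgebra C A) (ν : HomotopyAlgebra C B)
    (f : ℕ → HomS C.toWSMod A.toGradedMod B.toGradedMod 0) (n : ℕ) :
    HomS C.toWSMod A.toGradedMod B.toGradedMod (-1) :=
  (∑ k ∈ Finset.Icc 1 n, ast (f (n - k)) (wpart k μ.μ)) -
    ∑ k ∈ Finset.Icc 1 n, wpart n (circledast (wpart k ν.μ) (∑ j ∈ Finset.range n, f j))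

/-- The equation of `∞`-morphisms in weight `n`:
`∂^A_B f₍ₙ₎ - f₍ₙ₋₁₎ dφ = ∑_{k=1}^n f₍ₙ₋ₖ₎ ∗ μ₍ₖ₎ - ∑_{k=1}^n ν₍ₖ₎ ⊛ f₍ₙ₋ₖ₎`. -/
def WeightEq {A B : DGMod K} (μ : HomotopyAlgebra C A) (ν : HomotopyAlgebra C B)
    (f : ℕ → HomS C.toWSMod A.toGradedMod B.toGradedMod 0) (n : ℕ) : Prop :=
  (diff (f n) : HomS C.toWSMod A.toGradedMod B.toGradedMod (-1)) - precomp (prev f n) C.dφ =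
    weightRHS μ ν f n

/-- The obstruction
`∑_{k=1}^n f₍ₙ₋ₖ₎ ∗ μ₍ₖ₎ - ∑_{k=1}^n ν₍ₖ₎ ⊛ f₍ₙ₋ₖ₎ + f₍ₙ₋₁₎ dφ`. -/
noncomputable def obstruction {A B : DGMod K} (μ : HomotopyAlgebra C A)
    (ν : HomotopyAlgebra C B) (f : ℕ → HomS C.toWSMod A.toGradedMod B.toGradedMod 0) (n : ℕ) :
    HomS C.toWSMod A.toGradedMod B.toGradedMod (-1) :=
  weightRHS μ ν f n + precomp (prev f n) C.dφ

end infty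

end InftyMor

/-!
An `∞`-morphism is a morphism of cofree coalgebras that commutes with codifferentials, and
both halves of the theorem come from this description, carried out on Schur functors.

For a homotopy algebra `(A, μ)` write `M : C(A) → A` for the map given by `μ`. On `C(A)` there is
the codifferential `Q = C(id; d_A) + dφ + C(ε; M) Δ` (`DGCooperad.codiff`). It satisfies `Δ Q =
(C(id; Q) + dφ) Δ` (`DGCooperad.comul_codiff`), and the Maurer-Cartan equation says that `ε Q Q =
0`. Hence `Q Q = C(ε) Δ Q Q = C(ε) C(id; Q) C(id; Q) Δ`, which vanishes because the terms that
apply `Q` in two different positions cancel in pairs (`HomotopyAlgebra.codiff_codiff`).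

An element `f` of degree `0` gives `F : C(A) → B`. Its curvature `R = F Q - d_B F - N C(F) Δ`,
where `N` is the map given by `ν`, vanishes exactly when `f` is an `∞`-morphism. The coalgebra map
`C(F) Δ` commutes with the codifferentials up to the coderivation `C(F; R) Δ`
(`DGCooperad.codiff_schurMap_comul`). Composing the definition of `R` with `Q` gives the Bianchi
identity `d_B R + R Q + N C(F; R) Δ = 0` (`d_curvature`).

For the first half, take `f = f₍₀₎ + ⋯ + f₍ₙ₋₁₎`. The given equations say that `R` vanishes in the
weights less than `n`, and in weight `n` it is the obstruction (`curvature_agreeAt_zero`,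
`obstruction_agreeAt`). In weight `n` the terms of the Bianchi identity other than `d_B R + R
C(id; d_A)` only involve `R` in lower weights, since `μ` and `ν` vanish in weight `0` and `dφ`
lowers the weight. So the obstruction is a cycle. The criterion for `f₍ₙ₎` to exist holds because
the differential preserves the weight.

For the second half, an acyclic complex over a field has a contraction `h`, and then `F = d_B G +
G Q` with `G = h φ ε` satisfies `d_B F = d_B G Q = F Q`, so that it is an `∞`-morphism to `(B,
0)`. On weight `0` it is `d_B h φ + h φ d_A = (d_B h + h d_B) φ = φ`.
-/

namespace InftyMor

section functor

variable {K : Type u} [Field K]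

/-! ### Functoriality of the Schur functor and of its linearisation -/

theorem DegHom.map_sgn_zero {V W : GradedMod K} (f : DegHom V W 0) (v : V) :
    f.1 (V.sgn v) = W.sgn (f.1 v) := GradedMod.scale_comm _ f v

theorem DegHom.map_sgn_neg_one {V W : GradedMod K} (g : DegHom V W (-1)) (v : V) :
    g.1 (V.sgn v) = -W.sgn (g.1 v) := by
  have h1 : (-1 : K) ≠ 0 := by simp
  have : g.1 ∘ₗ V.sgn = -(W.sgn ∘ₗ g.1) := by
    refine GradedMod.hom_ext fun i v hv => ?_
    have e : (-1 : K) ^ (i + -1) = -(-1) ^ i := by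
      rw [zpow_add₀ h1]; simp
    rw [LinearMap.comp_apply, LinearMap.neg_apply, LinearMap.comp_apply, sgn_apply V hv,
      sgn_apply W (g.2 i v hv), e, map_smul, neg_smul, neg_neg]
  exact LinearMap.congr_fun this v

theorem GradedMod.sgn_sgn (V : GradedMod K) (v : V) : V.sgn (V.sgn v) = v := by
  have : V.sgn ∘ₗ V.sgn = LinearMap.id := by
    refine GradedMod.hom_ext fun i v hv => ?_
    rw [LinearMap.comp_apply, sgn_apply V hv, map_smul, sgn_apply V hv, smul_smul, ← mul_zpow]
    simp
  exact LinearMap.congr_fun this v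

theorem HomS.ext_apply {C : WSMod K} {V W : GradedMod K} {p : ℤ} {f g : HomS C V W p}
    (h : ∀ n c v, f.1 n c v = g.1 n c v) : f = g :=
  Subtype.ext (funext fun n => LinearMap.ext fun c => MultilinearMap.ext fun v => h n c v)

theorem mk_linFactor_add (C : WSMod K) {V W : GradedMod K} (f : DegHom V W 0)
    (g g' l : DegHom V W (-1)) (hl : l.1 = g.1 + g'.1) (n : ℕ) (c : C.obj n) (v : Fin n → V)
    (i : Fin n) :
    mk C W n c (fun j => linFactor f l i j (v j)) =
      mk C W n c (fun j => linFactor f g i j (v j)) +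
        mk C W n c (fun j => linFactor f g' i j (v j)) := by
  have upd : ∀ g : DegHom V W (-1), (fun j => linFactor f g i j (v j)) =
      Function.update (fun j => linFactor f 0 i j (v j)) i (g.1 (v i)) := by
    intro g
    funext j
    by_cases hj : j = i
    · subst hj
      simp [linFactor]
    · simp [linFactor, hj]
  rw [upd l, upd g, upd g', hl, LinearMap.add_apply, MultilinearMap.map_update_add]

variable [CharZero K]

theorem lift_mk {C : WSMod K} {V W : GradedMod K} {p : ℤ} (f : HomS C V W p) (n : ℕ)
    (c : C.obj n) (v : Fin n → V) : (lift f).1 (mk C V n c v) = f.1 n c v :=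
  liftAux_mk f.1 f.2.1 n c v

theorem restr_apply {C : WSMod K} {V W : GradedMod K} {p : ℤ} (h : DegHom (schur C V) W p)
    (n : ℕ) (c : C.obj n) (v : Fin n → V) : (restr h).1 n c v = h.1 (mk C V n c v) := rfl

theorem lift_restr {C : WSMod K} {V W : GradedMod K} {p : ℤ} (h : DegHom (schur C V) W p) :
    lift (restr h) = h :=
  Subtype.ext (schur_hom_ext fun n c v => by rw [lift_mk, restr_apply])

theorem lift_add {C : WSMod K} {V W : GradedMod K} {p : ℤ} (f g : HomS C V W p) :
    lift (f + g) = lift f + lift g :=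
  Subtype.ext (schur_hom_ext fun n c v =>
    (lift_mk (f + g) n c v).trans
      (congrArg₂ (· + ·) (lift_mk f n c v).symm (lift_mk g n c v).symm))

theorem schurMap_mk (C : WSMod K) {V W : GradedMod K} (f : DegHom V W 0) (n : ℕ) (c : C.obj n)
    (v : Fin n → V) : (schurMap C f).1 (mk C V n c v) = mk C W n c (fun i => f.1 (v i)) :=
  lift_mk _ n c v

theorem schurLin_mk (C : WSMod K) {V W : GradedMod K} (f : DegHom V W 0) (g : DegHom V W (-1))
    (n : ℕ) (c : C.obj n) (v : Fin n → V) : (schurLin C f g).1 (mk C V n c v) =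
      ∑ i : Fin n, mk C W n ((C.obj n).sgn c) (fun j => linFactor f g i j (v j)) :=
  (lift_mk _ n c v).trans (linFam_apply C f g n c v)

theorem schurEnd_mk {C : WSMod K} (δ : SEnd C) (V : GradedMod K) (n : ℕ) (c : C.obj n)
    (v : Fin n → V) : (δ.schur V).1 (mk C V n c v) = mk C V n ((δ.toFun n).1 c) v :=
  lift_mk _ n c v

theorem schurMap_comp (C : WSMod K) {U V W : GradedMod K} (f : DegHom U V 0) (f' : DegHom V W 0)
    (k : DegHom U W 0) (hk : k.1 = f'.1 ∘ₗ f.1) :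
    (schurMap C f').1 ∘ₗ (schurMap C f).1 = (schurMap C k).1 :=
  schur_hom_ext fun n c v => by
    rw [LinearMap.comp_apply, schurMap_mk, schurMap_mk, schurMap_mk, hk]
    rfl

theorem schurLin_comp_schurMap (C : WSMod K) {U V W : GradedMod K} (f : DegHom U V 0)
    (f' : DegHom V W 0) (g' : DegHom V W (-1)) (k : DegHom U W 0) (l : DegHom U W (-1))
    (hk : k.1 = f'.1 ∘ₗ f.1) (hl : l.1 = g'.1 ∘ₗ f.1) :
    (schurLin C f' g').1 ∘ₗ (schurMap C f).1 = (schurLin C k l).1 :=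
  schur_hom_ext fun n c v => by
    rw [LinearMap.comp_apply, schurMap_mk, schurLin_mk, schurLin_mk]
    refine Finset.sum_congr rfl fun i _ => congrArg _ (funext fun j => ?_)
    unfold linFactor
    split_ifs <;> simp [hk, hl]

theorem schurMap_comp_schurLin (C : WSMod K) {U V W : GradedMod K} (f : DegHom U V 0)
    (g : DegHom U V (-1)) (f' : DegHom V W 0) (k : DegHom U W 0) (l : DegHom U W (-1))
    (hk : k.1 = f'.1 ∘ₗ f.1) (hl : l.1 = f'.1 ∘ₗ g.1) :
    (schurMap C f').1 ∘ₗ (schurLin C f g).1 = (schurLin C k l).1 :=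
  schur_hom_ext fun n c v => by
    rw [LinearMap.comp_apply, schurLin_mk, schurLin_mk, map_sum]
    refine Finset.sum_congr rfl fun i _ => ?_
    rw [schurMap_mk]
    refine congrArg _ (funext fun j => ?_)
    unfold linFactor
    split_ifs <;> simp [hk, hl, DegHom.map_sgn_zero]

theorem schurLin_add (C : WSMod K) {V W : GradedMod K} (f : DegHom V W 0)
    (g g' l : DegHom V W (-1)) (hl : l.1 = g.1 + g'.1) :
    (schurLin C f l).1 = (schurLin C f g).1 + (schurLin C f g').1 :=
  schur_hom_ext fun n c v => by
    rw [LinearMap.add_apply, schurLin_mk, schurLin_mk, schurLin_mk, ← Finset.sum_add_distrib]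
    exact Finset.sum_congr rfl fun i _ => mk_linFactor_add C f g g' l hl n _ v i

theorem schurEnd_comp_schurMap {C : WSMod K} (δ : SEnd C) {V W : GradedMod K}
    (f : DegHom V W 0) :
    (δ.schur W).1 ∘ₗ (schurMap C f).1 = (schurMap C f).1 ∘ₗ (δ.schur V).1 :=
  schur_hom_ext fun n c v => by
    rw [LinearMap.comp_apply, LinearMap.comp_apply, schurMap_mk, schurEnd_mk, schurEnd_mk,
      schurMap_mk]

theorem schurEnd_comp_schurLin {C : WSMod K} (δ : SEnd C) {V W : GradedMod K}
    (f : DegHom V W 0) (g : DegHom V W (-1)) :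
    (δ.schur W).1 ∘ₗ (schurLin C f g).1 = -((schurLin C f g).1 ∘ₗ (δ.schur V).1) :=
  schur_hom_ext fun n c v => by
    rw [LinearMap.neg_apply, LinearMap.comp_apply, LinearMap.comp_apply, schurLin_mk,
      schurEnd_mk, schurLin_mk, map_sum, ← Finset.sum_neg_distrib]
    refine Finset.sum_congr rfl fun i _ => ?_
    rw [schurEnd_mk, DegHom.map_sgn_neg_one, map_neg]
    rfl

/-- The linearised Schur functor squares `g` only up to cross terms, which apply `g` in two
different positions; they cancel in pairs, because `g` anticommutes with the sign operator. -/
theorem schurMap_schurLin_schurLin_eq_zero (C : WSMod K) {V W : GradedMod K} (e : DegHom V W 0)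
    (g : DegHom V V (-1)) (h : ∀ v, e.1 (g.1 (g.1 v)) = 0) :
    (schurMap C e).1 ∘ₗ (schurLin C (DegHom.id V) g).1 ∘ₗ (schurLin C (DegHom.id V) g).1 = 0 :=
  schur_hom_ext fun n c v => by
    let t : Fin n → Fin n → SchurCarrier C W := fun i j => mk C W n c fun k =>
      e.1 (linFactor (DegHom.id V) g j k (linFactor (DegHom.id V) g i k (v k)))
    have hlt : ∀ i j, i < j → t i j = -t j i := by
      intro i j hij
      have : (fun k => e.1 (linFactor (DegHom.id V) g j k (linFactor (DegHom.id V) g i k (v k)))) =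
          Function.update (fun k => e.1 (linFactor (DegHom.id V) g i k
            (linFactor (DegHom.id V) g j k (v k)))) i
            (-e.1 (linFactor (DegHom.id V) g i i (linFactor (DegHom.id V) g j i (v i)))) := by
        funext k
        by_cases hki : k = i
        · subst hki
          simp [linFactor, hij, DegHom.id, DegHom.map_sgn_neg_one]
        · rw [Function.update_of_ne hki]
          congr 1
          by_cases hkj : k = j
          · subst hkj
            simp [linFactor, hij.not_gt, hij.ne', DegHom.id]
          · unfold linFactor
            simp only [hki, hkj, if_false]
            split_ifs <;> rfl
      show mk C W n c _ = -mk C W n c _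
      rw [this, MultilinearMap.map_update_neg, Function.update_eq_self]
    have hii : ∀ i, t i i = 0 := fun i =>
      MultilinearMap.map_coord_zero _ i (by simpa [linFactor] using h (v i))
    have hanti : ∀ i j, t i j = -t j i := by
      intro i j
      rcases lt_trichotomy i j with hij | hij | hij
      · exact hlt i j hij
      · subst hij
        rw [hii, neg_zero]
      · rw [hlt j i hij, neg_neg]
    have hS : ∑ i, ∑ j, t i j = 0 := by
      have hs : ∑ i, ∑ j, t i j = -∑ i, ∑ j, t i j := by
        conv_lhs => rw [Finset.sum_comm]
        rw [← Finset.sum_neg_distrib]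
        refine Finset.sum_congr rfl fun i _ => ?_
        rw [← Finset.sum_neg_distrib]
        exact Finset.sum_congr rfl fun j _ => hanti j i
      have h2 : (2 : K) • ∑ i, ∑ j, t i j = 0 := by
        rw [two_smul]
        nth_rewrite 2 [hs]
        exact add_neg_cancel _
      exact (smul_eq_zero.1 h2).resolve_left two_ne_zero
    rw [LinearMap.comp_apply, LinearMap.comp_apply, schurLin_mk, map_sum, map_sum,
      LinearMap.zero_apply, ← hS]
    refine Finset.sum_congr rfl fun i _ => ?_
    rw [schurLin_mk, map_sum, GradedMod.sgn_sgn]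
    exact Finset.sum_congr rfl fun j _ => schurMap_mk C e n c _

theorem counitMap_mk_one (C : WSMod K) (e : C.obj 1 →ₗ[K] K)
    (he : ∀ i, i ≠ 0 → ∀ c ∈ (C.obj 1).deg i, e c = 0) (V : GradedMod K) (c : C.obj 1)
    (v : Fin 1 → V) : (counitMap C e he V).1 (mk C V 1 c v) = e c • v 0 := by
  refine (lift_mk _ 1 c v).trans ?_
  simp [counitFam]

theorem counitMap_mk_ne (C : WSMod K) (e : C.obj 1 →ₗ[K] K)
    (he : ∀ i, i ≠ 0 → ∀ c ∈ (C.obj 1).deg i, e c = 0) (V : GradedMod K) {n : ℕ} (hn : n ≠ 1)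
    (c : C.obj n) (v : Fin n → V) : (counitMap C e he V).1 (mk C V n c v) = 0 := by
  refine (lift_mk _ n c v).trans ?_
  match n, hn with
  | 0, _ => rfl
  | n + 2, _ => rfl

theorem counitMap_comp_schurMap (C : WSMod K) (e : C.obj 1 →ₗ[K] K)
    (he : ∀ i, i ≠ 0 → ∀ c ∈ (C.obj 1).deg i, e c = 0) {V W : GradedMod K} (f : DegHom V W 0) :
    (counitMap C e he W).1 ∘ₗ (schurMap C f).1 = f.1 ∘ₗ (counitMap C e he V).1 :=
  schur_hom_ext fun n c v => by
    rw [LinearMap.comp_apply, LinearMap.comp_apply, schurMap_mk]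
    by_cases hn : n = 1
    · subst hn
      rw [counitMap_mk_one, counitMap_mk_one, map_smul]
    · rw [counitMap_mk_ne _ _ _ _ hn, counitMap_mk_ne _ _ _ _ hn, map_zero]

theorem counitMap_comp_schurLin (C : WSMod K) (e : C.obj 1 →ₗ[K] K)
    (he : ∀ i, i ≠ 0 → ∀ c ∈ (C.obj 1).deg i, e c = 0) {V W : GradedMod K} (f : DegHom V W 0)
    (g : DegHom V W (-1)) :
    (counitMap C e he W).1 ∘ₗ (schurLin C f g).1 = g.1 ∘ₗ (counitMap C e he V).1 :=
  schur_hom_ext fun n c v => by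
    rw [LinearMap.comp_apply, LinearMap.comp_apply, schurLin_mk, map_sum]
    by_cases hn : n = 1
    · subst hn
      have hs : e ∘ₗ (C.obj 1).sgn = e := by
        refine GradedMod.hom_ext fun i c hc => ?_
        rw [LinearMap.comp_apply, sgn_apply _ hc, map_smul]
        by_cases hi : i = 0
        · simp [hi]
        · rw [he i hi c hc, smul_zero]
      rw [Fin.sum_univ_one, counitMap_mk_one, counitMap_mk_one, map_smul,
        ← LinearMap.comp_apply e, hs]
      simp [linFactor]
    · rw [counitMap_mk_ne _ _ _ _ hn, map_zero]
      exact Finset.sum_eq_zero fun i _ => counitMap_mk_ne _ _ _ _ hn _ _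

end functor

section coderivations

variable {K : Type u} [Field K] [CharZero K]

/-! ### Coderivations and coalgebra maps -/

theorem schurMap_id (C : WSMod K) (V : GradedMod K) :
    schurMap C (DegHom.id V) = DegHom.id (schur C V) :=
  Subtype.ext (schur_hom_ext fun n c v => schurMap_mk C _ n c v)

/-- The coderivation `C(ε; M) ∘ Δ` of the cofree coalgebra `C(V)` which corresponds to
`M : C(V) → V`. -/
noncomputable def Cooperad.coder (C : Cooperad K) {V : GradedMod K}
    (M : DegHom (schur C.toWSMod V) V (-1)) :
    DegHom (schur C.toWSMod V) (schur C.toWSMod V) (-1) :=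
  DegHom.comp (schurLin C.toWSMod (C.eps V) M) (C.comul V)

theorem Cooperad.coder_apply (C : Cooperad K) {V : GradedMod K}
    (M : DegHom (schur C.toWSMod V) V (-1)) (x : schur C.toWSMod V) :
    (C.coder M).1 x = (schurLin C.toWSMod (C.eps V) M).1 ((C.comul V).1 x) := rfl

theorem Cooperad.comul_coder (C : Cooperad K) {V : GradedMod K}
    (M : DegHom (schur C.toWSMod V) V (-1)) :
    (C.comul V).1 ∘ₗ (C.coder M).1 =
      (schurLin C.toWSMod (DegHom.id _) (C.coder M)).1 ∘ₗ (C.comul V).1 := by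
  have h1 := C.comul_lin (C.eps V) M
  have h2 := C.coassoc V
  have h3 := schurLin_comp_schurMap C.toWSMod (C.comul V) (schurMap C.toWSMod (C.eps V))
    (schurLin C.toWSMod (C.eps V) M) (DegHom.id _) (C.coder M) (C.counit_right V).symm rfl
  calc (C.comul V).1 ∘ₗ (C.coder M).1
      = ((C.comul V).1 ∘ₗ (schurLin C.toWSMod (C.eps V) M).1) ∘ₗ (C.comul V).1 := rfl
    _ = (schurLin C.toWSMod (schurMap C.toWSMod (C.eps V))
          (schurLin C.toWSMod (C.eps V) M)).1 ∘ₗ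
          ((C.comul (schur C.toWSMod V)).1 ∘ₗ (C.comul V).1) := by rw [h1]; rfl
    _ = _ := by rw [← h2, ← LinearMap.comp_assoc, h3]

theorem Cooperad.comul_schurLin_id (C : Cooperad K) {V : GradedMod K} (d : DegHom V V (-1)) :
    (C.comul V).1 ∘ₗ (schurLin C.toWSMod (DegHom.id V) d).1 =
      (schurLin C.toWSMod (DegHom.id _) (schurLin C.toWSMod (DegHom.id V) d)).1 ∘ₗ
        (C.comul V).1 := by
  rw [C.comul_lin, schurMap_id]

theorem Cooperad.eps_coder (C : Cooperad K) {V : GradedMod K}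
    (M : DegHom (schur C.toWSMod V) V (-1)) :
    (C.eps V).1 ∘ₗ (C.coder M).1 = M.1 := by
  have h := counitMap_comp_schurLin C.toWSMod C.counit C.counit_deg (C.eps V) M
  calc (C.eps V).1 ∘ₗ (C.coder M).1
      = ((C.eps V).1 ∘ₗ (schurLin C.toWSMod (C.eps V) M).1) ∘ₗ (C.comul V).1 := rfl
    _ = M.1 ∘ₗ ((counitMap C.toWSMod C.counit C.counit_deg (schur C.toWSMod V)).1 ∘ₗ
          (C.comul V).1) := congrArg (· ∘ₗ (C.comul V).1) h
    _ = M.1 := by rw [C.counit_left, LinearMap.comp_id]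

/-- The codifferential `C(id; d_V) + dφ + C(ε; M) ∘ Δ` of `C(V)`. -/
noncomputable def DGCooperad.codiff (C : DGCooperad K) (V : DGMod K)
    (M : DegHom (schur C.toWSMod V.toGradedMod) V.toGradedMod (-1)) :
    DegHom (schur C.toWSMod V.toGradedMod) (schur C.toWSMod V.toGradedMod) (-1) :=
  schurLin C.toWSMod (DegHom.id _) V.d + C.dφ.schur V.toGradedMod + C.coder M

theorem DGCooperad.codiff_apply (C : DGCooperad K) (V : DGMod K)
    (M : DegHom (schur C.toWSMod V.toGradedMod) V.toGradedMod (-1))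
    (x : schur C.toWSMod V.toGradedMod) :
    (C.codiff V M).1 x = (schurLin C.toWSMod (DegHom.id _) V.d).1 x +
      (C.dφ.schur V.toGradedMod).1 x + (C.coder M).1 x := rfl

theorem DGCooperad.comul_codiff (C : DGCooperad K) (V : DGMod K)
    (M : DegHom (schur C.toWSMod V.toGradedMod) V.toGradedMod (-1)) :
    (C.comul V.toGradedMod).1 ∘ₗ (C.codiff V M).1 =
      ((schurLin C.toWSMod (DegHom.id _) (C.codiff V M)).1 + (C.dφ.schur _).1) ∘ₗ
        (C.comul V.toGradedMod).1 := by
  have h1 := C.comul_schurLin_id V.d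
  have h2 := C.coderivation V.toGradedMod
  have h3 := C.comul_coder M
  have h4 := schurLin_add C.toWSMod (DegHom.id (schur C.toWSMod V.toGradedMod))
    (schurLin C.toWSMod (DegHom.id _) V.d + C.dφ.schur V.toGradedMod) (C.coder M)
    (C.codiff V M) rfl
  have h5 := schurLin_add C.toWSMod (DegHom.id (schur C.toWSMod V.toGradedMod))
    (schurLin C.toWSMod (DegHom.id _) V.d) (C.dφ.schur V.toGradedMod)
    (schurLin C.toWSMod (DegHom.id _) V.d + C.dφ.schur V.toGradedMod) rfl
  have h6 : (C.codiff V M).1 = (schurLin C.toWSMod (DegHom.id _) V.d).1 +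
      (C.dφ.schur V.toGradedMod).1 + (C.coder M).1 := rfl
  rw [h4, h5, h6]
  simp only [LinearMap.comp_add, LinearMap.add_comp, h1, h2, h3]
  abel

theorem DGCooperad.eps_dφ (C : DGCooperad K) (V : GradedMod K) :
    (C.eps V).1 ∘ₗ (C.dφ.schur V).1 = 0 :=
  schur_hom_ext fun n c v => by
    rw [LinearMap.comp_apply, schurEnd_mk, LinearMap.zero_apply, Cooperad.eps]
    by_cases hn : n = 1
    · subst hn
      rw [counitMap_mk_one, C.counit_dφ, zero_smul]
    · exact counitMap_mk_ne _ _ _ _ hn _ _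

theorem DGCooperad.eps_codiff (C : DGCooperad K) (V : DGMod K)
    (M : DegHom (schur C.toWSMod V.toGradedMod) V.toGradedMod (-1))
    (x : schur C.toWSMod V.toGradedMod) :
    (C.eps V.toGradedMod).1 ((C.codiff V M).1 x) =
      V.d.1 ((C.eps V.toGradedMod).1 x) + M.1 x := by
  have h1 := LinearMap.congr_fun
    (counitMap_comp_schurLin C.toWSMod C.counit C.counit_deg (DegHom.id V.toGradedMod) V.d) x
  have h2 := LinearMap.congr_fun (C.eps_dφ V.toGradedMod) x
  have h3 := LinearMap.congr_fun (C.eps_coder M) x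
  simp only [LinearMap.comp_apply, LinearMap.zero_apply] at h1 h2 h3
  rw [codiff_apply, map_add, map_add, h2, h3, add_zero]
  exact congrArg (· + M.1 x) h1

/-- The Maurer-Cartan equation says that the codifferential of `C(A)` squares to zero after
projection to `A`. -/
theorem HomotopyAlgebra.d_lift_add {C : DGCooperad K} {A : DGMod K} (μ : HomotopyAlgebra C A)
    (x : schur C.toWSMod A.toGradedMod) :
    A.d.1 ((lift μ.μ).1 x) + (lift μ.μ).1 ((C.codiff A (lift μ.μ)).1 x) = 0 := by
  have : A.d.1 ∘ₗ (lift μ.μ).1 + (lift μ.μ).1 ∘ₗ (C.codiff A (lift μ.μ)).1 = 0 := by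
    refine schur_hom_ext fun n c v => ?_
    have h := congrArg (fun f : HomS C.toWSMod A.toGradedMod A.toGradedMod (-2) => f.1 n c v)
      μ.maurerCartan
    have h' : A.d.1 ((lift μ.μ).1 (InftyMor.mk _ _ n c v)) - (-1 : K) ^ (-1 : ℤ) •
        (lift μ.μ).1 ((schurLin C.toWSMod (DegHom.id _) A.d).1 (InftyMor.mk _ _ n c v)) +
        μ.μ.1 n ((C.dφ.toFun n).1 c) v +
        (lift μ.μ).1 ((C.coder (lift μ.μ)).1 (InftyMor.mk _ _ n c v)) = 0 := h
    rw [LinearMap.add_apply, LinearMap.comp_apply, LinearMap.comp_apply,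
      DGCooperad.codiff_apply, map_add, map_add, schurEnd_mk, lift_mk _ n ((C.dφ.toFun n).1 c),
      LinearMap.zero_apply, ← h']
    simp only [Int.reduceNeg, zpow_neg, zpow_one, inv_neg, inv_one, neg_smul, one_smul]
    abel
  exact LinearMap.congr_fun this x

/-- Since `Δ Q = (C(id; Q) + dφ) Δ`, the square of the codifferential `Q` is determined by its
projection `ε Q Q`, which vanishes. -/
theorem HomotopyAlgebra.codiff_codiff {C : DGCooperad K} {A : DGMod K} (μ : HomotopyAlgebra C A)
    (x : schur C.toWSMod A.toGradedMod) :
    (C.codiff A (lift μ.μ)).1 ((C.codiff A (lift μ.μ)).1 x) = 0 := by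
  set Q := C.codiff A (lift μ.μ) with hQ
  have hε : ∀ y, (C.eps A.toGradedMod).1 (Q.1 (Q.1 y)) = 0 := fun y => by
    rw [C.eps_codiff, C.eps_codiff, map_add, A.d_comp_d, zero_add]
    exact μ.d_lift_add y
  have hΔ : ∀ y, (C.comul A.toGradedMod).1 (Q.1 y) =
      (schurLin C.toWSMod (DegHom.id _) Q).1 ((C.comul A.toGradedMod).1 y) +
        (C.dφ.schur _).1 ((C.comul A.toGradedMod).1 y) :=
    fun y => LinearMap.congr_fun (C.comul_codiff A (lift μ.μ)) y
  have hr : ∀ y, (schurMap C.toWSMod (C.eps A.toGradedMod)).1 ((C.comul A.toGradedMod).1 y) = y :=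
    fun y => LinearMap.congr_fun (C.counit_right A.toGradedMod) y
  have hΦ : ∀ y, (C.dφ.schur (schur C.toWSMod A.toGradedMod)).1 ((C.dφ.schur _).1 y) = 0 := by
    intro y
    have : (C.dφ.schur (schur C.toWSMod A.toGradedMod)).1 ∘ₗ (C.dφ.schur _).1 = 0 :=
      schur_hom_ext fun n c v => by
        rw [LinearMap.comp_apply, schurEnd_mk, schurEnd_mk, C.dφ_dφ, map_zero]
        rfl
    exact LinearMap.congr_fun this y
  have hc : ∀ y, (C.dφ.schur (schur C.toWSMod A.toGradedMod)).1
      ((schurLin C.toWSMod (DegHom.id _) Q).1 y) =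
        -(schurLin C.toWSMod (DegHom.id _) Q).1 ((C.dφ.schur _).1 y) :=
    fun y => LinearMap.congr_fun (schurEnd_comp_schurLin C.dφ (DegHom.id _) Q) y
  have h0 := LinearMap.congr_fun (schurMap_schurLin_schurLin_eq_zero C.toWSMod
    (C.eps A.toGradedMod) Q hε) ((C.comul A.toGradedMod).1 x)
  rw [← hr (Q.1 (Q.1 x)), hΔ, hΔ, map_add (schurLin C.toWSMod (DegHom.id _) Q).1,
    map_add (C.dφ.schur (schur C.toWSMod A.toGradedMod)).1, hc, hΦ, add_zero,
    add_neg_cancel_right]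
  exact h0

/-- The failure of the coalgebra map `C(F) ∘ Δ` to commute with the codifferentials is the
coderivation `C(F; R) ∘ Δ` along it, where `R` is the projection of that failure to `B`. -/
theorem DGCooperad.codiff_schurMap_comul (C : DGCooperad K) {A B : DGMod K}
    (M : DegHom (schur C.toWSMod A.toGradedMod) A.toGradedMod (-1))
    (N : DegHom (schur C.toWSMod B.toGradedMod) B.toGradedMod (-1))
    (F : DegHom (schur C.toWSMod A.toGradedMod) B.toGradedMod 0)
    (R : DegHom (schur C.toWSMod A.toGradedMod) B.toGradedMod (-1))
    (hR : ∀ x, F.1 ((C.codiff A M).1 x) = R.1 x + B.d.1 (F.1 x) +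
      N.1 ((schurMap C.toWSMod F).1 ((C.comul A.toGradedMod).1 x)))
    (x : schur C.toWSMod A.toGradedMod) :
    (schurMap C.toWSMod F).1 ((C.comul A.toGradedMod).1 ((C.codiff A M).1 x)) =
      (C.codiff B N).1 ((schurMap C.toWSMod F).1 ((C.comul A.toGradedMod).1 x)) +
      (schurLin C.toWSMod F R).1 ((C.comul A.toGradedMod).1 x) := by
  let dF : DegHom (schur C.toWSMod A.toGradedMod) B.toGradedMod (-1) := DegHom.comp B.d F
  let NF : DegHom (schur C.toWSMod A.toGradedMod) B.toGradedMod (-1) :=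
    DegHom.comp N (DegHom.comp (r := 0) (schurMap C.toWSMod F) (C.comul A.toGradedMod))
  -- the left-hand side, with `ΔQ = (C(id; Q) + dφ)Δ`
  have h1 : (C.comul A.toGradedMod).1 ((C.codiff A M).1 x) =
      (schurLin C.toWSMod (DegHom.id _) (C.codiff A M)).1 ((C.comul A.toGradedMod).1 x) +
        (C.dφ.schur _).1 ((C.comul A.toGradedMod).1 x) :=
    LinearMap.congr_fun (C.comul_codiff A M) x
  have h2 : ∀ y, (schurMap C.toWSMod F).1
      ((schurLin C.toWSMod (DegHom.id _) (C.codiff A M)).1 y) =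
        (schurLin C.toWSMod F R).1 y + (schurLin C.toWSMod F dF).1 y +
          (schurLin C.toWSMod F NF).1 y := by
    intro y
    have e1 := schurMap_comp_schurLin C.toWSMod (DegHom.id _) (C.codiff A M) F F (R + dF + NF) rfl
      (LinearMap.ext fun z => (hR z).symm)
    have e2 := schurLin_add C.toWSMod F (R + dF) NF (R + dF + NF) rfl
    have e3 := schurLin_add C.toWSMod F R dF (R + dF) rfl
    have := LinearMap.congr_fun e1 y
    rw [e2, e3] at this
    exact this
  have h3 : ∀ y, (C.dφ.schur _).1 ((schurMap C.toWSMod F).1 y) =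
      (schurMap C.toWSMod F).1 ((C.dφ.schur _).1 y) :=
    fun y => LinearMap.congr_fun (schurEnd_comp_schurMap C.dφ F) y
  have h4 : ∀ y, (schurLin C.toWSMod (DegHom.id _) B.d).1 ((schurMap C.toWSMod F).1 y) =
      (schurLin C.toWSMod F dF).1 y :=
    fun y => LinearMap.congr_fun
      (schurLin_comp_schurMap C.toWSMod F (DegHom.id _) B.d F dF rfl rfl) y
  -- `C(ε; N) Δ C(F) Δ = C(ε; N) C(C(F)) C(Δ) Δ = C(F; N C(F) Δ) Δ`
  have h5 : (C.coder N).1 ((schurMap C.toWSMod F).1 ((C.comul A.toGradedMod).1 x)) =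
      (schurLin C.toWSMod F NF).1 ((C.comul A.toGradedMod).1 x) := by
    have e1 : (C.comul B.toGradedMod).1 ((schurMap C.toWSMod F).1
        ((C.comul A.toGradedMod).1 x)) = (schurMap C.toWSMod (schurMap C.toWSMod F)).1
          ((C.comul _).1 ((C.comul A.toGradedMod).1 x)) :=
      LinearMap.congr_fun (C.comul_map F) _
    have e2 : (C.comul (schur C.toWSMod A.toGradedMod)).1 ((C.comul A.toGradedMod).1 x) =
        (schurMap C.toWSMod (C.comul A.toGradedMod)).1 ((C.comul A.toGradedMod).1 x) :=
      (LinearMap.congr_fun (C.coassoc A.toGradedMod) x).symm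
    let k : DegHom (schur C.toWSMod A.toGradedMod) (schur C.toWSMod B.toGradedMod) 0 :=
      DegHom.comp (schurMap C.toWSMod F) (C.comul A.toGradedMod)
    have e3 := schurMap_comp C.toWSMod (C.comul A.toGradedMod) (schurMap C.toWSMod F) k rfl
    have e4 : F.1 = (C.eps B.toGradedMod).1 ∘ₗ k.1 := by
      have a1 := counitMap_comp_schurMap C.toWSMod C.counit C.counit_deg F
      have a2 := C.counit_left A.toGradedMod
      calc F.1 = F.1 ∘ₗ ((counitMap C.toWSMod C.counit C.counit_deg
            (schur C.toWSMod A.toGradedMod)).1 ∘ₗ (C.comul A.toGradedMod).1) := by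
              rw [a2, LinearMap.comp_id]
        _ = _ := by rw [← LinearMap.comp_assoc, ← a1]; rfl
    have e5 := schurLin_comp_schurMap C.toWSMod k (C.eps B.toGradedMod) N F NF e4 rfl
    rw [Cooperad.coder_apply, e1, e2]
    have e6 := LinearMap.congr_fun e3 ((C.comul A.toGradedMod).1 x)
    have e7 := LinearMap.congr_fun e5 ((C.comul A.toGradedMod).1 x)
    rw [LinearMap.comp_apply] at e6 e7
    rw [e6, e7]
  rw [h1, map_add, h2, C.codiff_apply, h4, h5, h3]
  abel

/-- The Bianchi identity of the curvature `R` of `F`. -/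
theorem d_curvature {C : DGCooperad K} {A B : DGMod K} (μ : HomotopyAlgebra C A)
    (ν : HomotopyAlgebra C B) (F : DegHom (schur C.toWSMod A.toGradedMod) B.toGradedMod 0)
    (R : DegHom (schur C.toWSMod A.toGradedMod) B.toGradedMod (-1))
    (hR : ∀ x, F.1 ((C.codiff A (lift μ.μ)).1 x) = R.1 x + B.d.1 (F.1 x) +
      (lift ν.μ).1 ((schurMap C.toWSMod F).1 ((C.comul A.toGradedMod).1 x)))
    (x : schur C.toWSMod A.toGradedMod) :
    B.d.1 (R.1 x) + R.1 ((C.codiff A (lift μ.μ)).1 x) +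
      (lift ν.μ).1 ((schurLin C.toWSMod F R).1 ((C.comul A.toGradedMod).1 x)) = 0 := by
  have h1 := hR ((C.codiff A (lift μ.μ)).1 x)
  have h2 := congrArg B.d.1 (hR x)
  have h3 := ν.d_lift_add ((schurMap C.toWSMod F).1 ((C.comul A.toGradedMod).1 x))
  rw [μ.codiff_codiff, map_zero, C.codiff_schurMap_comul _ _ F R hR, map_add] at h1
  rw [map_add, map_add, B.d_comp_d, add_zero] at h2
  rw [h2] at h1
  have h4 := h1.symm
  rw [← sub_eq_zero.2 (h4.trans h3.symm)]
  abel

end coderivations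

section contraction

/-! ### Contracting homotopies of acyclic complexes -/

variable {K : Type u} [Field K]

theorem GradedMod.exists_linearMap (V : GradedMod K) {X : Type*} [AddCommGroup X] [Module K X]
    (φ : ℤ → (V →ₗ[K] X)) : ∃ F : V →ₗ[K] X, ∀ i, ∀ v ∈ V.deg i, F v = φ i v := by
  refine ⟨(DirectSum.toModule K ℤ X fun i => φ i ∘ₗ (V.deg i).subtype) ∘ₗ
    (LinearEquiv.ofBijective (DirectSum.coeLinearMap V.deg) V.bijective).symm.toLinearMap,
    fun i v hv => ?_⟩
  have : (LinearEquiv.ofBijective (DirectSum.coeLinearMap V.deg) V.bijective).symm v =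
      DirectSum.lof K ℤ (fun i => V.deg i) i ⟨v, hv⟩ := by
    rw [LinearEquiv.symm_apply_eq]
    simp
  simp [this]

/-- The projection of a graded vector space onto its part of degree `i`. -/
noncomputable def GradedMod.degProj (V : GradedMod K) (i : ℤ) : V →ₗ[K] V :=
  V.scale fun k => if k = i then 1 else 0

theorem GradedMod.degProj_apply (V : GradedMod K) (i : ℤ) {k : ℤ} {v : V} (hv : v ∈ V.deg k) :
    V.degProj i v = if k = i then v else 0 := by
  rw [degProj, V.scale_apply _ hv]
  split_ifs <;> simp

theorem GradedMod.degProj_mem (V : GradedMod K) (i : ℤ) (v : V) : V.degProj i v ∈ V.deg i := by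
  induction V.mem_iSup v using Submodule.iSup_induction' with
  | mem k x hx =>
    rw [V.degProj_apply i hx]
    split_ifs with h
    · exact h ▸ hx
    · exact zero_mem _
  | zero => simp
  | add x y _ _ hx hy => simpa using add_mem hx hy

theorem DegHom.map_degProj {V W : GradedMod K} {p : ℤ} (f : DegHom V W p) (i : ℤ) (v : V) :
    f.1 (V.degProj i v) = W.degProj (i + p) (f.1 v) := by
  have : f.1 ∘ₗ V.degProj i = W.degProj (i + p) ∘ₗ f.1 := by
    refine GradedMod.hom_ext fun k v hv => ?_
    rw [LinearMap.comp_apply, LinearMap.comp_apply, V.degProj_apply i hv,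
      W.degProj_apply _ (f.2 k v hv)]
    by_cases h : k = i <;> simp [h]
  exact LinearMap.congr_fun this v

/-- Over a field, an acyclic complex is contractible. -/
theorem DGMod.Acyclic.exists_contraction {B : DGMod K} (hB : B.Acyclic) :
    ∃ h : DegHom B.toGradedMod B.toGradedMod 1, ∀ b, B.d.1 (h.1 b) + h.1 (B.d.1 b) = b := by
  obtain ⟨s, hs⟩ := B.d.1.rangeRestrict.exists_rightInverse_of_surjective
    (LinearMap.range_rangeRestrict _)
  obtain ⟨t, ht⟩ := s.exists_extend
  have hdtd : ∀ x, B.d.1 (t (B.d.1 x)) = B.d.1 x := by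
    intro x
    have h1 : t (B.d.1 x) = s (B.d.1.rangeRestrict x) :=
      LinearMap.congr_fun ht (B.d.1.rangeRestrict x)
    have h2 := LinearMap.congr_fun hs (B.d.1.rangeRestrict x)
    rw [h1]
    exact congrArg Subtype.val h2
  -- the part `g` of degree `1` of `t` is still a generalised inverse of the differential
  obtain ⟨g, hg⟩ := B.toGradedMod.exists_linearMap fun i => B.toGradedMod.degProj (i + 1) ∘ₗ t
  have hdgd : ∀ x, B.d.1 (g (B.d.1 x)) = B.d.1 x := by
    have : B.d.1 ∘ₗ g ∘ₗ B.d.1 = B.d.1 := by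
      refine GradedMod.hom_ext fun i x hx => ?_
      have hdx := B.d.2 i x hx
      rw [LinearMap.comp_apply, LinearMap.comp_apply, hg _ _ hdx, LinearMap.comp_apply,
        DegHom.map_degProj, hdtd, GradedMod.degProj_apply _ _ hdx, if_pos (by ring)]
    exact LinearMap.congr_fun this
  let g' : DegHom B.toGradedMod B.toGradedMod 1 :=
    ⟨g, fun i v hv => by rw [hg i v hv]; exact GradedMod.degProj_mem _ _ _⟩
  let h' : DegHom B.toGradedMod B.toGradedMod 1 :=
    DegHom.comp (r := 1) (DegHom.comp (r := 0) B.d g') g'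
  -- `h = (1 - d g) g`
  refine ⟨g' - h', fun b => ?_⟩
  have e : ∀ b, (g' - h').1 b = g b - B.d.1 (g (g b)) := fun b => rfl
  obtain ⟨b', hb'⟩ := hB (g (B.d.1 b) - b) (by rw [map_sub, hdgd, sub_self])
  have h3 : B.d.1 (g (g (B.d.1 b) - b)) = g (B.d.1 b) - b := by
    rw [← hb', hdgd]
  rw [map_sub, map_sub] at h3
  rw [e, e, map_sub, B.d_comp_d, sub_zero]
  have h4 : B.d.1 (g (g (B.d.1 b))) = g (B.d.1 b) - b + B.d.1 (g b) := by
    rw [← h3, sub_add_cancel]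
  rw [h4]
  abel

end contraction

section defect

variable {K : Type u} [Field K] [CharZero K] {C : DGCooperad K}

/-! ### The curvature of a map and extensions to acyclic complexes -/

/-- The failure `f ∗ μ - ν ⊛ f + f dφ - ∂^A_B f` of `f` to be an `∞`-morphism. -/
noncomputable def curvature {A B : DGMod K} (μ : HomotopyAlgebra C A) (ν : HomotopyAlgebra C B)
    (f : HomS C.toWSMod A.toGradedMod B.toGradedMod 0) :
    HomS C.toWSMod A.toGradedMod B.toGradedMod (-1) :=
  ast f μ.μ - circledast ν.μ f + precomp f C.dφ - diff f

theorem isInftyMorphism_iff {A B : DGMod K} (μ : HomotopyAlgebra C A) (ν : HomotopyAlgebra C B)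
    (f : HomS C.toWSMod A.toGradedMod B.toGradedMod 0) :
    IsInftyMorphism μ ν f ↔ curvature μ ν f = 0 := by
  unfold IsInftyMorphism curvature
  constructor
  · intro h
    have e : ast f μ.μ - circledast ν.μ f + precomp f C.dφ - diff f =
        (ast f μ.μ - circledast ν.μ f : HomS C.toWSMod _ _ (-1)) -
          (diff f - precomp f C.dφ) := by abel
    rw [e, h]
    exact sub_self (ast f μ.μ - circledast ν.μ f)
  · intro h
    have e : diff f - precomp f C.dφ = (ast f μ.μ - circledast ν.μ f : HomS C.toWSMod _ _ (-1)) -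
        (ast f μ.μ - circledast ν.μ f + precomp f C.dφ - diff f) := by abel
    rw [e, h]
    exact sub_zero (ast f μ.μ - circledast ν.μ f)

theorem diff_apply {A B : DGMod K} {p q : ℤ}
    (f : HomS C.toWSMod A.toGradedMod B.toGradedMod p) (h : q = p - 1) (n : ℕ)
    (c : C.obj n) (v : Fin n → A.toGradedMod) :
    (diff f h).1 n c v = B.d.1 (f.1 n c v) - (-1 : K) ^ p •
      (lift f).1 ((schurLin C.toWSMod (DegHom.id _) A.d).1 (mk _ A.toGradedMod n c v)) := by
  rw [← lift_mk f]
  rfl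

theorem curvature_apply {A B : DGMod K} (μ : HomotopyAlgebra C A) (ν : HomotopyAlgebra C B)
    (f : HomS C.toWSMod A.toGradedMod B.toGradedMod 0) (n : ℕ) (c : C.obj n)
    (v : Fin n → A.toGradedMod) :
    (curvature μ ν f).1 n c v =
      (lift f).1 ((C.codiff A (lift μ.μ)).1 (mk _ A.toGradedMod n c v)) -
        B.d.1 ((lift f).1 (mk _ A.toGradedMod n c v)) -
        (lift ν.μ).1 ((schurMap C.toWSMod (lift f)).1
          ((C.comul A.toGradedMod).1 (mk _ A.toGradedMod n c v))) := by
  have h : (curvature μ ν f).1 n c v = (lift f).1 ((C.coder (lift μ.μ)).1 (mk _ _ n c v)) -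
      (lift ν.μ).1 ((schurMap C.toWSMod (lift f)).1
          ((C.comul A.toGradedMod).1 (mk _ A.toGradedMod n c v))) +
      f.1 n ((C.dφ.toFun n).1 c) v - (diff f : HomS C.toWSMod _ _ (-1)).1 n c v := rfl
  rw [h, diff_apply, C.codiff_apply, map_add, map_add, schurEnd_mk, lift_mk, lift_mk, zpow_zero,
    one_smul]
  abel

theorem lift_codiff {A B : DGMod K} (μ : HomotopyAlgebra C A) (ν : HomotopyAlgebra C B)
    (f : HomS C.toWSMod A.toGradedMod B.toGradedMod 0) (x : schur C.toWSMod A.toGradedMod) :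
    (lift f).1 ((C.codiff A (lift μ.μ)).1 x) = (lift (curvature μ ν f)).1 x +
      B.d.1 ((lift f).1 x) + (lift ν.μ).1 ((schurMap C.toWSMod (lift f)).1
          ((C.comul A.toGradedMod).1 x)) := by
  have : (lift f).1 ∘ₗ (C.codiff A (lift μ.μ)).1 = (lift (curvature μ ν f)).1 +
      B.d.1 ∘ₗ (lift f).1 + (lift ν.μ).1 ∘ₗ (schurMap C.toWSMod (lift f)).1 ∘ₗ
          (C.comul A.toGradedMod).1 :=
    schur_hom_ext fun n c v => by
      rw [LinearMap.add_apply, LinearMap.add_apply, lift_mk (curvature μ ν f), curvature_apply]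
      simp only [LinearMap.comp_apply]
      abel
  exact LinearMap.congr_fun this x

/-- If `h` is a contraction of `B`, then `d_B G + G Q` with `G = h φ ε` and with `Q` the
codifferential of `C(A)` is an `∞`-morphism that extends `φ`. -/
theorem exists_inftyMorphism_extending {A B : DGMod K} (μ : HomotopyAlgebra C A)
    (hB : B.Acyclic) (φ : DegHom A.toGradedMod B.toGradedMod 0)
    (hφ : ∀ a, φ.1 (A.d.1 a) = B.d.1 (φ.1 a)) :
    ∃ f : HomS C.toWSMod A.toGradedMod B.toGradedMod 0,
      IsInftyMorphism μ (HomotopyAlgebra.trivial C B) f ∧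
        ∀ a, f.1 1 C.one (fun _ => a) = φ.1 a := by
  obtain ⟨h, hh⟩ := hB.exists_contraction
  let G : DegHom (schur C.toWSMod A.toGradedMod) B.toGradedMod 1 :=
    DegHom.comp h (DegHom.comp (r := 0) φ (C.eps A.toGradedMod))
  let Q := C.codiff A (lift μ.μ)
  let F : DegHom (schur C.toWSMod A.toGradedMod) B.toGradedMod 0 :=
    DegHom.comp B.d G + DegHom.comp G Q
  have hF : ∀ x, F.1 x = B.d.1 (G.1 x) + G.1 (Q.1 x) := fun _ => rfl
  have hG : ∀ x, G.1 x = h.1 (φ.1 ((C.eps A.toGradedMod).1 x)) := fun _ => rfl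
  refine ⟨restr F, ?_, fun a => ?_⟩
  · rw [isInftyMorphism_iff]
    refine HomS.ext_apply fun n c v => ?_
    rw [curvature_apply, lift_restr, hF, hF, μ.codiff_codiff, map_zero, add_zero, map_add,
      B.d_comp_d, zero_add, sub_self, zero_sub]
    have : (lift (HomotopyAlgebra.trivial C B).μ).1 = 0 :=
      congrArg Subtype.val (lift_zero (C := C.toWSMod) (V := B.toGradedMod) (W := B.toGradedMod))
    rw [this, LinearMap.zero_apply, neg_zero]
    rfl
  · have hone : C.one ∈ C.weight 1 0 := by
      rw [C.weight_zero_one]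
      exact Submodule.mem_span_singleton_self _
    have hμ : μ.μ.1 1 C.one (fun _ => a) = 0 := by
      have := congrArg (fun f : HomS C.toWSMod A.toGradedMod A.toGradedMod (-1) =>
        f.1 1 C.one (fun _ => a)) μ.vanish
      have h' : μ.μ.1 1 (C.proj 1 0 C.one) (fun _ => a) = 0 := this
      rwa [C.proj_apply hone, if_pos rfl] at h'
    have hε : (C.eps A.toGradedMod).1 (mk _ _ 1 C.one (fun _ => a)) = a := by
      rw [Cooperad.eps, counitMap_mk_one, C.counit_one, one_smul]
    rw [restr_apply, hF, hG, hG, C.eps_codiff, hε, lift_mk, hμ, add_zero, hφ, hh]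

end defect

section weights

variable {K : Type u} [Field K]

/-! ### Restriction to a weight -/

/-- The elements `f` and `g` have the same restriction to the part of weight `w`. -/
def AgreeAt {C : WSMod K} {V W : GradedMod K} {p : ℤ} (w : ℕ) (f g : HomS C V W p) : Prop :=
  ∀ n, ∀ c ∈ C.weight n w, f.1 n c = g.1 n c

namespace AgreeAt

variable {C : WSMod K} {V W : GradedMod K} {p q : ℤ} {w : ℕ} {f g h f' g' : HomS C V W p}

theorem refl (f : HomS C V W p) : AgreeAt w f f := fun _ _ _ => rfl

theorem symm (h : AgreeAt w f g) : AgreeAt w g f := fun n c hc => (h n c hc).symm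

theorem trans (h₁ : AgreeAt w f g) (h₂ : AgreeAt w g h) : AgreeAt w f h :=
  fun n c hc => (h₁ n c hc).trans (h₂ n c hc)

theorem add (h : AgreeAt w f g) (h' : AgreeAt w f' g') : AgreeAt w (f + f') (g + g') :=
  fun n c hc => congrArg₂ (· + ·) (h n c hc) (h' n c hc)

theorem sub (h : AgreeAt w f g) (h' : AgreeAt w f' g') : AgreeAt w (f - f') (g - g') :=
  fun n c hc => congrArg₂ (· - ·) (h n c hc) (h' n c hc)

theorem add_zero (h : AgreeAt w f 0) (h' : AgreeAt w f' 0) : AgreeAt w (f + f') 0 := by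
  have := h.add h'
  rwa [_root_.add_zero] at this

theorem sub_zero (h : AgreeAt w f 0) (h' : AgreeAt w f' 0) : AgreeAt w (f - f') 0 :=
  fun n c hc => (congrArg₂ (· - ·) (h n c hc) (h' n c hc)).trans (_root_.sub_zero _)

theorem sum {ι : Type*} (s : Finset ι) {a b : ι → HomS C V W p}
    (hab : ∀ i ∈ s, AgreeAt w (a i) (b i)) : AgreeAt w (∑ i ∈ s, a i) (∑ i ∈ s, b i) := by
  classical
  induction s using Finset.induction_on with
  | empty => exact refl _
  | insert i s hi ih =>
    rw [Finset.sum_insert hi, Finset.sum_insert hi]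
    exact (hab i (by simp)).add (ih fun j hj => hab j (by simp [hj]))

theorem sum_zero {ι : Type*} (s : Finset ι) {a : ι → HomS C V W p}
    (ha : ∀ i ∈ s, AgreeAt w (a i) 0) : AgreeAt w (∑ i ∈ s, a i) 0 := by
  have := AgreeAt.sum s ha
  rwa [Finset.sum_const_zero] at this

/-- A sum with a single nonzero term in weight `w`. -/
theorem sum_single {ι : Type*} {s : Finset ι} {a : ι → HomS C V W p} {i : ι} (hi : i ∈ s)
    (h0 : ∀ j ∈ s, j ≠ i → AgreeAt w (a j) 0) (hg : AgreeAt w (a i) g) :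
    AgreeAt w (∑ j ∈ s, a j) g := by
  classical
  rw [← Finset.add_sum_erase s a hi]
  have := hg.add (sum_zero (s.erase i) fun j hj =>
    h0 j (Finset.mem_of_mem_erase hj) (Finset.ne_of_mem_erase hj))
  rwa [_root_.add_zero] at this

end AgreeAt

theorem inWeight_iff {C : WSMod K} {V W : GradedMod K} {p : ℤ} {w : ℕ} {f : HomS C V W p} :
    InWeight w f ↔ ∀ w', w' ≠ w → AgreeAt w' f 0 :=
  ⟨fun h w' hw n c hc => h n w' hw c hc, fun h n w' hw c hc => h w' hw n c hc⟩

variable [CharZero K]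

theorem HomS.ext_weight {C : WSMod K} {V W : GradedMod K} {p : ℤ} {f g : HomS C V W p}
    (h : ∀ w, AgreeAt w f g) : f = g :=
  Subtype.ext (funext fun n => C.hom_ext fun w c hc => h w n c hc)

theorem wpart_agreeAt {C : WSMod K} {V W : GradedMod K} {p : ℤ} (w : ℕ) (f : HomS C V W p) :
    AgreeAt w (wpart w f) f := fun n c hc => by
  show f.1 n (C.proj n w c) = _
  rw [C.proj_apply hc, if_pos rfl]

theorem wpart_agreeAt_of_ne {C : WSMod K} {V W : GradedMod K} {p : ℤ} {w w' : ℕ} (hw : w' ≠ w)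
    (f : HomS C V W p) : AgreeAt w' (wpart w f) 0 := fun n c hc => by
  show f.1 n (C.proj n w c) = 0
  rw [C.proj_apply hc, if_neg hw, map_zero]

theorem WSMod.sgn_mem_weight (C : WSMod K) {n w : ℕ} {c : C.obj n} (hc : c ∈ C.weight n w) :
    (C.obj n).sgn c ∈ C.weight n w := by
  let P : DegHom (C.obj n) (C.obj n) 0 :=
    ⟨C.proj n w, fun i c hc => by simpa using C.proj_deg n w hc⟩
  have h : P.1 ((C.obj n).sgn c) = (C.obj n).sgn (C.proj n w c) := DegHom.map_sgn_zero P c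
  rw [C.proj_apply hc, if_pos rfl] at h
  rw [← h]
  exact Subtype.prop _

theorem mk_mem_schurWeight (C : WSMod K) (V : GradedMod K) {n w : ℕ} {c : C.obj n}
    (hc : c ∈ C.weight n w) (v : Fin n → V) :
    mk C V n c v ∈ schurWeight C V (weightZero V) w :=
  Submodule.subset_span ⟨n, c, v, w, fun _ => 0, hc, fun i => by simp [weightZero], by simp, rfl⟩

theorem schurWeight_induction {C : WSMod K} {V : GradedMod K} {X : Type*} [AddCommGroup X]
    [Module K X] {w : ℕ} {S T : SchurCarrier C V →ₗ[K] X}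
    (h : ∀ n, ∀ c ∈ C.weight n w, ∀ v, S (mk C V n c v) = T (mk C V n c v))
    {x : SchurCarrier C V} (hx : x ∈ schurWeight C V (weightZero V) w) : S x = T x := by
  suffices H : schurWeight C V (weightZero V) w ≤ LinearMap.eqLocus S T from H hx
  rw [schurWeight, Submodule.span_le]
  rintro _ ⟨n, c, v, a, q, hc, hv, rfl, rfl⟩
  rw [SetLike.mem_coe, LinearMap.mem_eqLocus]
  by_cases hq : ∀ i, q i = 0
  · exact h n c (by simpa [hq] using hc) v
  · push Not at hq
    obtain ⟨i, hi⟩ := hq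
    have : v i = 0 := by
      have := hv i
      rwa [weightZero, if_neg hi, Submodule.mem_bot] at this
    rw [MultilinearMap.map_coord_zero _ i this, map_zero, map_zero]

theorem AgreeAt.lift_eq {C : WSMod K} {V W : GradedMod K} {p : ℤ} {w : ℕ} {f g : HomS C V W p}
    (h : AgreeAt w f g) {x : schur C V} (hx : x ∈ schurWeight C V (weightZero V) w) :
    (lift f).1 x = (lift g).1 x :=
  schurWeight_induction (S := (lift f).1) (T := (lift g).1)
    (fun n c hc v => by rw [lift_mk, lift_mk, h n c hc]) hx

theorem AgreeAt.lift_eq_zero {C : WSMod K} {V W : GradedMod K} {p : ℤ} {w : ℕ}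
    {f : HomS C V W p} (h : AgreeAt w f 0) {x : schur C V}
    (hx : x ∈ schurWeight C V (weightZero V) w) : (lift f).1 x = 0 := by
  rw [h.lift_eq hx, lift_zero]
  rfl

theorem Cooperad.eps_eq_zero (C : Cooperad K) {V : GradedMod K} {w : ℕ} (hw : w ≠ 0)
    {x : schur C.toWSMod V} (hx : x ∈ schurWeight C.toWSMod V (weightZero V) w) :
    (C.eps V).1 x = 0 :=
  schurWeight_induction (S := (C.eps V).1) (T := 0) (fun n c hc v => by
    rw [LinearMap.zero_apply, Cooperad.eps]
    by_cases hn : n = 1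
    · subst hn
      rw [counitMap_mk_one, C.counit_weight w hw c hc, zero_smul]
    · exact counitMap_mk_ne _ _ _ _ hn _ _) hx

/-- Two maps on `C(C(V))` agree on the image of the part of weight `w` under `Δ` as soon as they
agree on the elements `[c ⊗ x₁ ⊗ ⋯ ⊗ xₙ]` of total weight `w`. -/
theorem Cooperad.comul_induction (C : Cooperad K) {V : GradedMod K} {X : Type*} [AddCommGroup X]
    [Module K X] {w : ℕ} {S T : SchurCarrier C.toWSMod (schur C.toWSMod V) →ₗ[K] X}
    (h : ∀ (n a : ℕ) (q : Fin n → ℕ) (c : C.obj n) (x : Fin n → schur C.toWSMod V),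
      c ∈ C.weight n a → (∀ i, x i ∈ schurWeight C.toWSMod V (weightZero V) (q i)) →
        a + ∑ i, q i = w → S (InftyMor.mk _ (schur C.toWSMod V) n c x) = T (InftyMor.mk _ _ n c x))
    {y : schur C.toWSMod V} (hy : y ∈ schurWeight C.toWSMod V (weightZero V) w) :
    S ((C.comul V).1 y) = T ((C.comul V).1 y) := by
  suffices H : schurWeight C.toWSMod (schur C.toWSMod V)
      (schurWeight C.toWSMod V (weightZero V)) w ≤ LinearMap.eqLocus S T from
    H (C.comul_weight V w y hy)
  rw [schurWeight, Submodule.span_le]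
  rintro _ ⟨n, c, x, a, q, hc, hx, hw, rfl⟩
  exact h n a q c x hc hx hw

end weights

section products

variable {K : Type u} [Field K] [CharZero K] {C : DGCooperad K} {A B : DGMod K}

/-! ### Weights of the differential and of the products -/

theorem diff_agreeAt {p q w : _} {f g : HomS C.toWSMod A.toGradedMod B.toGradedMod p}
    (hpq : q = p - 1) (h : AgreeAt w f g) : AgreeAt w (diff f hpq) (diff g hpq) := by
  intro n c hc
  ext v
  rw [diff_apply, diff_apply, h n c hc, schurLin_mk, map_sum, map_sum]
  congr 2
  refine Finset.sum_congr rfl fun i _ => ?_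
  rw [lift_mk, lift_mk, h n _ (C.sgn_mem_weight hc)]

theorem diff_agreeAt_zero {p q w : _} {f : HomS C.toWSMod A.toGradedMod B.toGradedMod p}
    (hpq : q = p - 1) (h : AgreeAt w f 0) : AgreeAt w (diff f hpq) 0 := by
  have := diff_agreeAt hpq h
  rwa [diff_zero] at this

theorem precomp_agreeAt_succ {p q w : _} {f g : HomS C.toWSMod A.toGradedMod B.toGradedMod p}
    (hpq : q = p - 1) (h : AgreeAt w f g) :
    AgreeAt (w + 1) (precomp f C.dφ hpq) (precomp g C.dφ hpq) :=
  fun n c hc => h n _ (C.dφ_weight_succ n w c hc)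

theorem precomp_agreeAt_zero {p q : _} (f : HomS C.toWSMod A.toGradedMod B.toGradedMod p)
    (hpq : q = p - 1) : AgreeAt 0 (precomp f C.dφ hpq) 0 := fun n c hc => by
  show f.1 n ((C.dφ.toFun n).1 c) = 0
  rw [C.dφ_weight_zero n c hc, map_zero]

/-- The part of `f ∗ μ` of weight `w` is bilinear in the parts of `f` and `μ` whose weights add up
to `w`. -/
theorem ast_agreeAt {p q w : _} {f f' : HomS C.toWSMod A.toGradedMod B.toGradedMod p}
    {μ μ' : HomS C.toWSMod A.toGradedMod A.toGradedMod (-1)} (hpq : q = p - 1)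
    (h : ∀ a b, a + b = w → (AgreeAt a f f' ∧ AgreeAt b μ μ') ∨
      (AgreeAt a f 0 ∧ AgreeAt a f' 0) ∨ (AgreeAt b μ 0 ∧ AgreeAt b μ' 0)) :
    AgreeAt w (ast f μ hpq) (ast f' μ' hpq) := by
  intro n c hc
  ext v
  refine C.comul_induction
    (S := (lift f).1 ∘ₗ (schurLin C.toWSMod (C.eps A.toGradedMod) (lift μ)).1)
    (T := (lift f').1 ∘ₗ (schurLin C.toWSMod (C.eps A.toGradedMod) (lift μ')).1) ?_
    (mk_mem_schurWeight C.toWSMod A.toGradedMod hc v)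
  clear hc v c n
  intro n a q c x hc hx hw
  have hs := C.sgn_mem_weight hc
  rw [LinearMap.comp_apply, LinearMap.comp_apply, schurLin_mk, schurLin_mk, map_sum, map_sum]
  refine Finset.sum_congr rfl fun i _ => ?_
  rw [lift_mk, lift_mk]
  by_cases hq : ∃ j, j ≠ i ∧ q j ≠ 0
  · -- a factor of positive weight is killed by the counit
    obtain ⟨j, hj, hqj⟩ := hq
    have h0 : ∀ g, linFactor (C.eps A.toGradedMod) g i j (x j) = 0 := by
      intro g
      have := C.eps_eq_zero hqj (hx j)
      unfold linFactor
      simp only [hj, if_false]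
      split_ifs
      · rw [LinearMap.comp_apply, this, map_zero]
      · exact this
    rw [MultilinearMap.map_coord_zero _ j (h0 _), MultilinearMap.map_coord_zero _ j (h0 _)]
  · push Not at hq
    have hsum : a + q i = w := by
      rw [← hw, Finset.sum_eq_single i (fun j _ hj => hq j hj) (by simp)]
    have hfac : ∀ g, linFactor (C.eps A.toGradedMod) g i i (x i) = g.1 (x i) := by
      intro g
      simp [linFactor]
    have hupd : ∀ g : DegHom (schur C.toWSMod A.toGradedMod) A.toGradedMod (-1),
        g.1 (x i) = 0 → linFactor (C.eps A.toGradedMod) g i i (x i) = 0 :=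
      fun g hg => (hfac g).trans hg
    rcases h a (q i) hsum with ⟨hf, hμ⟩ | ⟨hf, hf'⟩ | ⟨hμ, hμ'⟩
    · rw [hf n _ hs]
      congr 1
      funext j
      unfold linFactor
      split_ifs with h1 h2
      · rfl
      · subst h2
        exact hμ.lift_eq (hx j)
      · rfl
    · rw [hf n _ hs, hf' n _ hs]
      rfl
    · rw [MultilinearMap.map_coord_zero _ i (hupd _ (hμ.lift_eq_zero (hx i))),
        MultilinearMap.map_coord_zero _ i (hupd _ (hμ'.lift_eq_zero (hx i)))]

theorem ast_zero_left {p q : _} (hpq : q = p - 1)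
    (μ : HomS C.toWSMod A.toGradedMod A.toGradedMod (-1)) :
    ast (0 : HomS C.toWSMod A.toGradedMod B.toGradedMod p) μ hpq = 0 := by
  rw [ast, lift_zero]
  rfl

theorem ast_agreeAt_zero {p q w : _} {f : HomS C.toWSMod A.toGradedMod B.toGradedMod p}
    {μ : HomS C.toWSMod A.toGradedMod A.toGradedMod (-1)} (hpq : q = p - 1)
    (h : ∀ a b, a + b = w → AgreeAt a f 0 ∨ AgreeAt b μ 0) : AgreeAt w (ast f μ hpq) 0 := by
  rw [← ast_zero_left (A := A) (B := B) hpq μ]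
  refine ast_agreeAt hpq fun a b hab => ?_
  rcases h a b hab with h | h
  · exact Or.inr (Or.inl ⟨h, AgreeAt.refl _⟩)
  · exact Or.inr (Or.inr ⟨h, h⟩)

/-- The part of `ν ⊛ f` of weight `w` depends on the parts of `ν` of weight `a` and on the parts of
`f` of weight at most `w - a`. -/
theorem circledast_agreeAt {w : ℕ} {f f' : HomS C.toWSMod A.toGradedMod B.toGradedMod 0}
    {ν ν' : HomS C.toWSMod B.toGradedMod B.toGradedMod (-1)}
    (h : ∀ a b, a + b = w → (AgreeAt a ν ν' ∧ ∀ q ≤ b, AgreeAt q f f') ∨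
      (AgreeAt a ν 0 ∧ AgreeAt a ν' 0)) :
    AgreeAt w (circledast ν f) (circledast ν' f') := by
  intro n c hc
  ext v
  refine C.comul_induction (S := (lift ν).1 ∘ₗ (schurMap C.toWSMod (lift f)).1)
    (T := (lift ν').1 ∘ₗ (schurMap C.toWSMod (lift f')).1) ?_
    (mk_mem_schurWeight C.toWSMod A.toGradedMod hc v)
  clear hc v c n
  intro n a q c x hc hx hw
  rw [LinearMap.comp_apply, LinearMap.comp_apply, schurMap_mk, schurMap_mk, lift_mk, lift_mk]
  rcases h a _ hw with ⟨hν, hf⟩ | ⟨hν, hν'⟩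
  · rw [hν n c hc]
    congr 1
    funext i
    exact (hf (q i) (Finset.single_le_sum (fun _ _ => Nat.zero_le _) (Finset.mem_univ i))).lift_eq
      (hx i)
  · rw [hν n c hc, hν' n c hc]
    rfl

/-- The linearisation of `ν ⊛ f` at `f` in the direction `r` vanishes in weight `w` if `ν` vanishes
in weight `0` and `r` in the weights less than `w`. -/
theorem lift_schurLin_comul_eq_zero {w : ℕ}
    {ν : HomS C.toWSMod B.toGradedMod B.toGradedMod (-1)} (hν : AgreeAt 0 ν 0)
    (f : HomS C.toWSMod A.toGradedMod B.toGradedMod 0)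
    {r : HomS C.toWSMod A.toGradedMod B.toGradedMod (-1)} (hr : ∀ w' < w, AgreeAt w' r 0)
    {y : schur C.toWSMod A.toGradedMod}
    (hy : y ∈ schurWeight C.toWSMod A.toGradedMod (weightZero _) w) :
    (lift ν).1 ((schurLin C.toWSMod (lift f) (lift r)).1 ((C.comul A.toGradedMod).1 y)) = 0 := by
  refine C.comul_induction (S := (lift ν).1 ∘ₗ (schurLin C.toWSMod (lift f) (lift r)).1)
    (T := 0) ?_ hy
  intro n a q c x hc hx hw
  rw [LinearMap.comp_apply, schurLin_mk, map_sum, LinearMap.zero_apply]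
  refine Finset.sum_eq_zero fun i _ => ?_
  rw [lift_mk]
  by_cases ha : a = 0
  · subst ha
    rw [hν n _ (C.sgn_mem_weight hc)]
    rfl
  · have hi : q i ≤ ∑ i, q i :=
      Finset.single_le_sum (fun _ _ => Nat.zero_le _) (Finset.mem_univ i)
    refine MultilinearMap.map_coord_zero _ i ?_
    have := (hr (q i) (by omega)).lift_eq_zero (hx i)
    simpa [linFactor] using this

theorem ast_sum_left {p q : _} {ι : Type*} (s : Finset ι)
    (f : ι → HomS C.toWSMod A.toGradedMod B.toGradedMod p)
    (μ : HomS C.toWSMod A.toGradedMod A.toGradedMod (-1)) (hpq : q = p - 1) :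
    ast (∑ i ∈ s, f i) μ hpq = ∑ i ∈ s, ast (f i) μ hpq := by
  classical
  induction s using Finset.induction_on with
  | empty => exact ast_zero_left hpq μ
  | insert i s hi ih =>
    rw [Finset.sum_insert hi, Finset.sum_insert hi, ← ih]
    have : lift (f i + ∑ i ∈ s, f i) = lift (f i) + lift (∑ i ∈ s, f i) := lift_add _ _
    rw [ast, this]
    rfl

theorem circledast_sum_left {ι : Type*} (s : Finset ι)
    (ν : ι → HomS C.toWSMod B.toGradedMod B.toGradedMod (-1))
    (f : HomS C.toWSMod A.toGradedMod B.toGradedMod 0) :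
    circledast (∑ i ∈ s, ν i) f = ∑ i ∈ s, circledast (ν i) f := by
  classical
  induction s using Finset.induction_on with
  | empty =>
    rw [Finset.sum_empty, Finset.sum_empty, circledast, lift_zero]
    rfl
  | insert i s hi ih =>
    rw [Finset.sum_insert hi, Finset.sum_insert hi, ← ih]
    have : lift (ν i + ∑ i ∈ s, ν i) = lift (ν i) + lift (∑ i ∈ s, ν i) := lift_add _ _
    rw [circledast, this]
    rfl

end products

section obstruction

variable {K : Type u} [Field K] [CharZero K] {C : DGCooperad K} {A B : DGMod K}

/-! ### The obstruction -/

theorem HomotopyAlgebra.agreeAt_zero (μ : HomotopyAlgebra C A) : AgreeAt 0 μ.μ 0 := by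
  have := wpart_agreeAt 0 μ.μ
  rw [μ.vanish] at this
  exact this.symm

theorem sum_agreeAt {f : ℕ → HomS C.toWSMod A.toGradedMod B.toGradedMod 0} {n k : ℕ}
    (hf : ∀ k < n, InWeight k (f k)) (hk : k < n) :
    AgreeAt k (∑ j ∈ Finset.range n, f j) (f k) :=
  AgreeAt.sum_single (Finset.mem_range.2 hk)
    (fun j hj hjk => inWeight_iff.1 (hf j (Finset.mem_range.1 hj)) k hjk.symm) (AgreeAt.refl _)

theorem sum_agreeAt_zero {f : ℕ → HomS C.toWSMod A.toGradedMod B.toGradedMod 0} {n k : ℕ}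
    (hf : ∀ k < n, InWeight k (f k)) (hk : n ≤ k) :
    AgreeAt k (∑ j ∈ Finset.range n, f j) 0 :=
  AgreeAt.sum_zero _ fun j hj => by
    have := Finset.mem_range.1 hj
    exact inWeight_iff.1 (hf j this) k (by omega)

theorem wpart_sum_agreeAt {W : GradedMod K} {p : ℤ} (ν : HomS C.toWSMod W W p)
    {m a : ℕ} (ha : a ∈ Finset.Icc 1 m) :
    AgreeAt a (∑ k ∈ Finset.Icc 1 m, wpart k ν) ν :=
  AgreeAt.sum_single ha (fun _ _ hj => wpart_agreeAt_of_ne hj.symm ν) (wpart_agreeAt a ν)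

/-- In weight `m`, the products of the components `f₍₀₎, …, f₍ₙ₋₁₎` are the components of the
products of their sum. -/
theorem weightRHS_agreeAt (μ : HomotopyAlgebra C A) (ν : HomotopyAlgebra C B) {n m : ℕ}
    {f : ℕ → HomS C.toWSMod A.toGradedMod B.toGradedMod 0}
    (hf : ∀ k < n, InWeight k (f k)) (hm : m ≤ n) :
    AgreeAt m (weightRHS μ ν f m) (ast (∑ j ∈ Finset.range n, f j) μ.μ -
      circledast ν.μ (∑ j ∈ Finset.range n, f j)) := by
  refine AgreeAt.sub ?_ ?_
  · have e : ∑ k ∈ Finset.Icc 1 m, ast (f (m - k)) (wpart k μ.μ) =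
        ∑ j ∈ Finset.range m, (ast (f j) (wpart (m - j) μ.μ) :
          HomS C.toWSMod A.toGradedMod B.toGradedMod (-1)) := by
      refine Finset.sum_nbij' (fun k => m - k) (fun j => m - j) ?_ ?_ ?_ ?_ ?_
      · intro k hk
        simp only [Finset.mem_Icc, Finset.mem_range] at *
        omega
      · intro k hk
        simp only [Finset.mem_Icc, Finset.mem_range] at *
        omega
      · intro k hk
        simp only [Finset.mem_Icc] at hk
        omega
      · intro k hk
        simp only [Finset.mem_range] at hk
        omega
      · intro k hk
        simp only [Finset.mem_Icc] at hk
        rw [Nat.sub_sub_self hk.2]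
    rw [e, ← Finset.sum_range_add_sum_Ico _ hm]
    have h1 : AgreeAt m (∑ j ∈ Finset.range m, (ast (f j) (wpart (m - j) μ.μ) :
        HomS C.toWSMod A.toGradedMod B.toGradedMod (-1)))
        (ast (∑ j ∈ Finset.range m, f j) μ.μ) := by
      rw [ast_sum_left]
      refine AgreeAt.sum _ fun j hj => ast_agreeAt _ fun a b hab => ?_
      have hj' := Finset.mem_range.1 hj
      by_cases haj : a = j
      · have hb : b = m - j := by omega
        subst hb
        exact Or.inl ⟨AgreeAt.refl _, wpart_agreeAt _ _⟩
      · have := inWeight_iff.1 (hf j (by omega)) a haj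
        exact Or.inr (Or.inl ⟨this, this⟩)
    refine h1.trans (ast_agreeAt _ fun a b hab => ?_)
    by_cases hb : b = 0
    · subst hb
      exact Or.inr (Or.inr ⟨μ.agreeAt_zero, μ.agreeAt_zero⟩)
    · refine Or.inl ⟨?_, AgreeAt.refl _⟩
      have := (AgreeAt.refl (w := a) (∑ j ∈ Finset.range m, f j)).add
        (AgreeAt.sum_zero (Finset.Ico m n) (a := f) fun j hj => by
          have := Finset.mem_Ico.1 hj
          exact inWeight_iff.1 (hf j (by omega)) a (by omega))
      rw [add_zero] at this
      exact this.symm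
  · have h1 : AgreeAt m (∑ k ∈ Finset.Icc 1 m,
        wpart m (circledast (wpart k ν.μ) (∑ j ∈ Finset.range m, f j)))
        (circledast (∑ k ∈ Finset.Icc 1 m, wpart k ν.μ) (∑ j ∈ Finset.range m, f j)) := by
      rw [circledast_sum_left]
      exact AgreeAt.sum _ fun k _ => wpart_agreeAt _ _
    refine h1.trans (circledast_agreeAt fun a b hab => ?_)
    by_cases ha : a = 0
    · subst ha
      refine Or.inr ⟨AgreeAt.sum_zero _ fun k hk => wpart_agreeAt_of_ne ?_ _, ν.agreeAt_zero⟩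
      have := Finset.mem_Icc.1 hk
      omega
    · refine Or.inl ⟨wpart_sum_agreeAt _ (Finset.mem_Icc.2 (by omega)), fun q hq => ?_⟩
      exact (sum_agreeAt (fun k hk => hf k (by omega)) (by omega)).trans
        (sum_agreeAt hf (by omega)).symm

theorem precomp_prev_agreeAt {n m : ℕ}
    {f : ℕ → HomS C.toWSMod A.toGradedMod B.toGradedMod 0}
    (hf : ∀ k < n, InWeight k (f k)) (hm : m ≤ n) :
    AgreeAt m (precomp (prev f m) C.dφ : HomS C.toWSMod A.toGradedMod B.toGradedMod (-1))
      (precomp (∑ j ∈ Finset.range n, f j) C.dφ) := by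
  cases m with
  | zero => exact (precomp_agreeAt_zero _ _).trans (precomp_agreeAt_zero _ _).symm
  | succ m => exact precomp_agreeAt_succ _ (sum_agreeAt hf (by omega)).symm

theorem obstruction_inWeight (μ : HomotopyAlgebra C A) (ν : HomotopyAlgebra C B) {n : ℕ}
    {f : ℕ → HomS C.toWSMod A.toGradedMod B.toGradedMod 0}
    (hf : ∀ k < n, InWeight k (f k)) : InWeight n (obstruction μ ν f n) := by
  refine inWeight_iff.2 fun w hw => ?_
  refine AgreeAt.add_zero (AgreeAt.sub_zero ?_ ?_) ?_
  · refine AgreeAt.sum_zero _ fun k hk => ast_agreeAt_zero _ fun a b hab => ?_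
    have hk' := Finset.mem_Icc.1 hk
    by_cases hb : b = k
    · exact Or.inl (inWeight_iff.1 (hf (n - k) (by omega)) a (by omega))
    · exact Or.inr (wpart_agreeAt_of_ne hb _)
  · exact AgreeAt.sum_zero _ fun k _ => wpart_agreeAt_of_ne hw _
  · cases w with
    | zero => exact precomp_agreeAt_zero _ _
    | succ w =>
      refine precomp_agreeAt_succ (g := 0) _ ?_
      cases n with
      | zero => exact AgreeAt.refl _
      | succ n => exact inWeight_iff.1 (hf n (by omega)) w (by omega)

/-- The equations of `∞`-morphisms in the weights `m < n` say that the curvature of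
`f₍₀₎ + ⋯ + f₍ₙ₋₁₎` vanishes in the weights less than `n`. -/
theorem curvature_agreeAt_zero (μ : HomotopyAlgebra C A) (ν : HomotopyAlgebra C B) {n m : ℕ}
    {f : ℕ → HomS C.toWSMod A.toGradedMod B.toGradedMod 0}
    (hf : ∀ k < n, InWeight k (f k)) (hm : m < n) (heq : WeightEq μ ν f m) :
    AgreeAt m (curvature μ ν (∑ j ∈ Finset.range n, f j)) 0 := by
  have h1 := ((weightRHS_agreeAt μ ν hf hm.le).add (precomp_prev_agreeAt hf hm.le)).sub
    (diff_agreeAt (q := -1) (by norm_num) (sum_agreeAt hf hm).symm)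
  have h2 : weightRHS μ ν f m + precomp (prev f m) C.dφ - diff (f m) = 0 := by
    rw [← heq]
    abel
  rw [h2] at h1
  exact h1.symm

/-- In weight `n`, the obstruction is the curvature of `f₍₀₎ + ⋯ + f₍ₙ₋₁₎`. -/
theorem obstruction_agreeAt (μ : HomotopyAlgebra C A) (ν : HomotopyAlgebra C B) {n : ℕ}
    {f : ℕ → HomS C.toWSMod A.toGradedMod B.toGradedMod 0}
    (hf : ∀ k < n, InWeight k (f k)) :
    AgreeAt n (obstruction μ ν f n) (curvature μ ν (∑ j ∈ Finset.range n, f j)) := by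
  have h1 := ((weightRHS_agreeAt μ ν hf le_rfl).add (precomp_prev_agreeAt hf le_rfl)).sub
    (diff_agreeAt_zero (q := -1) (by norm_num) (sum_agreeAt_zero hf le_rfl)).symm
  have h2 : weightRHS μ ν f n + precomp (prev f n) C.dφ - 0 = obstruction μ ν f n :=
    sub_zero (obstruction μ ν f n)
  rw [h2] at h1
  exact h1

/-- The Bianchi identity in weight `n`, where its terms other than `d_B R + R C(id; d_A)` only
involve the curvature `R` in the weights less than `n`. -/
theorem diff_curvature_agreeAt_zero (μ : HomotopyAlgebra C A) (ν : HomotopyAlgebra C B) {n : ℕ}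
    {f : HomS C.toWSMod A.toGradedMod B.toGradedMod 0}
    (hf : ∀ m < n, AgreeAt m (curvature μ ν f) 0) :
    AgreeAt n (diff (curvature μ ν f) : HomS C.toWSMod A.toGradedMod B.toGradedMod (-2)) 0 := by
  intro k c hc
  ext v
  have hmk := mk_mem_schurWeight C.toWSMod A.toGradedMod hc v
  have h1 := d_curvature μ ν (lift f) (lift (curvature μ ν f)) (lift_codiff μ ν f)
    (mk _ A.toGradedMod k c v)
  rw [lift_schurLin_comul_eq_zero ν.agreeAt_zero f hf hmk, C.codiff_apply, map_add, map_add,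
    schurEnd_mk, lift_mk, lift_mk] at h1
  have h2 : (curvature μ ν f).1 k ((C.dφ.toFun k).1 c) v = 0 := by
    have : AgreeAt n (precomp (curvature μ ν f) C.dφ :
        HomS C.toWSMod A.toGradedMod B.toGradedMod (-2)) 0 := by
      cases n with
      | zero => exact precomp_agreeAt_zero _ _
      | succ n => exact precomp_agreeAt_succ (g := 0) _ (hf n (by omega))
    exact DFunLike.congr_fun (this k c hc) v
  have h3 : (lift (curvature μ ν f)).1 ((C.coder (lift μ.μ)).1
      (mk _ A.toGradedMod k c v)) = 0 := by
    have : AgreeAt n (ast (curvature μ ν f) μ.μ :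
        HomS C.toWSMod A.toGradedMod B.toGradedMod (-2)) 0 := by
      refine ast_agreeAt_zero _ fun a b hab => ?_
      by_cases hb : b = 0
      · subst hb
        exact Or.inr μ.agreeAt_zero
      · exact Or.inl (hf a (by omega))
    exact DFunLike.congr_fun (this k c hc) v
  rw [h2, h3, add_zero, add_zero, add_zero] at h1
  rw [diff_apply]
  simp only [Int.reduceNeg, zpow_neg, zpow_one, inv_neg, inv_one, neg_smul, one_smul,
    sub_neg_eq_add]
  exact h1

theorem diff_obstruction (μ : HomotopyAlgebra C A) (ν : HomotopyAlgebra C B) {n : ℕ}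
    {f : ℕ → HomS C.toWSMod A.toGradedMod B.toGradedMod 0}
    (hf : ∀ k < n, InWeight k (f k)) (heq : ∀ k < n, WeightEq μ ν f k) :
    (diff (obstruction μ ν f n) : HomS C.toWSMod A.toGradedMod B.toGradedMod (-2)) = 0 := by
  refine HomS.ext_weight fun w => ?_
  by_cases hw : w = n
  · subst hw
    exact (diff_agreeAt _ (obstruction_agreeAt μ ν hf)).trans
      (diff_curvature_agreeAt_zero μ ν fun m hm => curvature_agreeAt_zero μ ν hf hm (heq m hm))
  · exact diff_agreeAt_zero _ (inWeight_iff.1 (obstruction_inWeight μ ν hf) w hw)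

theorem weightEq_update_iff (μ : HomotopyAlgebra C A) (ν : HomotopyAlgebra C B) (n : ℕ)
    (f : ℕ → HomS C.toWSMod A.toGradedMod B.toGradedMod 0)
    (g : HomS C.toWSMod A.toGradedMod B.toGradedMod 0) :
    WeightEq μ ν (Function.update f n g) n ↔ diff g = obstruction μ ν f n := by
  have h1 : prev (Function.update f n g) n = prev f n := by
    cases n with
    | zero => rfl
    | succ n => exact Function.update_of_ne (by omega) _ _
  have h2 : weightRHS μ ν (Function.update f n g) n = weightRHS μ ν f n := by
    have e1 : ∑ k ∈ Finset.Icc 1 n, ast (Function.update f n g (n - k)) (wpart k μ.μ) =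
        ∑ k ∈ Finset.Icc 1 n, (ast (f (n - k)) (wpart k μ.μ) :
          HomS C.toWSMod A.toGradedMod B.toGradedMod (-1)) := by
      refine Finset.sum_congr rfl fun k hk => ?_
      have := Finset.mem_Icc.1 hk
      rw [Function.update_of_ne (by omega)]
    have e2 : ∑ j ∈ Finset.range n, Function.update f n g j = ∑ j ∈ Finset.range n, f j := by
      refine Finset.sum_congr rfl fun j hj => ?_
      have := Finset.mem_range.1 hj
      rw [Function.update_of_ne (by omega)]
    rw [weightRHS, weightRHS, e1, e2]
  rw [WeightEq, h1, h2, Function.update_self, obstruction]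
  exact sub_eq_iff_eq_add (G := HomS C.toWSMod A.toGradedMod B.toGradedMod (-1))

/-- The differential preserves the weight, so that a primitive of an element that lives in weight
`n` can be replaced by its part of weight `n`. -/
theorem diff_wpart_of_inWeight {p q : ℤ} (hpq : q = p - 1) {n : ℕ}
    {b : HomS C.toWSMod A.toGradedMod B.toGradedMod p}
    (hb : InWeight n (diff b hpq)) : diff (wpart n b) hpq = diff b hpq := by
  refine HomS.ext_weight fun w => ?_
  by_cases hw : w = n
  · subst hw
    exact diff_agreeAt _ (wpart_agreeAt _ _)
  · exact (diff_agreeAt_zero _ (wpart_agreeAt_of_ne hw _)).trans (inWeight_iff.1 hb w hw).symm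

theorem exists_weightEq_iff (μ : HomotopyAlgebra C A) (ν : HomotopyAlgebra C B) {n : ℕ}
    {f : ℕ → HomS C.toWSMod A.toGradedMod B.toGradedMod 0}
    (hf : ∀ k < n, InWeight k (f k)) :
    (∃ g : HomS C.toWSMod A.toGradedMod B.toGradedMod 0,
        InWeight n g ∧ WeightEq μ ν (Function.update f n g) n) ↔
      ∃ b : HomS C.toWSMod A.toGradedMod B.toGradedMod 0, diff b = obstruction μ ν f n := by
  constructor
  · rintro ⟨g, -, hg⟩
    exact ⟨g, (weightEq_update_iff μ ν n f g).1 hg⟩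
  · rintro ⟨b, hb⟩
    refine ⟨wpart n b, inWeight_iff.2 fun w hw => wpart_agreeAt_of_ne hw b,
      (weightEq_update_iff μ ν n f _).2 ?_⟩
    rw [← hb]
    refine diff_wpart_of_inWeight _ ?_
    rw [hb]
    exact obstruction_inWeight μ ν hf

end obstruction

end InftyMor

theorem mainTheorem12 {K : Type u} [Field K] [CharZero K] (C : InftyMor.DGCooperad K) :
    (∀ (A B : InftyMor.DGMod K) (μ : InftyMor.HomotopyAlgebra C A)
        (ν : InftyMor.HomotopyAlgebra C B) (n : ℕ)
        (f : ℕ → InftyMor.HomS C.toWSMod A.toGradedMod B.toGradedMod 0),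
      (∀ k < n, InftyMor.InWeight k (f k)) → (∀ k < n, InftyMor.WeightEq μ ν f k) →
        InftyMor.InWeight n (InftyMor.obstruction μ ν f n) ∧
        (InftyMor.diff (InftyMor.obstruction μ ν f n) :
          InftyMor.HomS C.toWSMod A.toGradedMod B.toGradedMod (-2)) = 0 ∧
        ((∃ g : InftyMor.HomS C.toWSMod A.toGradedMod B.toGradedMod 0,
            InftyMor.InWeight n g ∧ InftyMor.WeightEq μ ν (Function.update f n g) n) ↔
          ∃ b : InftyMor.HomS C.toWSMod A.toGradedMod B.toGradedMod 0,
            InftyMor.diff b = InftyMor.obstruction μ ν f n)) ∧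
    (∀ (A B : InftyMor.DGMod K) (μ : InftyMor.HomotopyAlgebra C A), B.Acyclic →
      ∀ φ : InftyMor.DegHom A.toGradedMod B.toGradedMod 0, (∀ a, φ.1 (A.d.1 a) = B.d.1 (φ.1 a)) →
        ∃ f : InftyMor.HomS C.toWSMod A.toGradedMod B.toGradedMod 0,
          InftyMor.IsInftyMorphism μ (InftyMor.HomotopyAlgebra.trivial C B) f ∧
            ∀ a, f.1 1 C.one (fun _ => a) = φ.1 a) :=
  ⟨fun _ _ μ ν _ _ hf heq => ⟨InftyMor.obstruction_inWeight μ ν hf,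
      InftyMor.diff_obstruction μ ν hf heq, InftyMor.exists_weightEq_iff μ ν hf⟩,
    fun _ _ μ hB φ hφ => InftyMor.exists_inftyMorphism_extending μ hB φ hφ⟩
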